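/- **Setting.** Let $s\ge 1$, $m\ge 3$, $s<m$. Write $z=(t_1,\dots,t_s,x_1,\dots,x_{m-s})\in\mathbb R^m_s$, $\langle z,w\rangle=-\sum_i t_i(z)t_i(w)+\sum_j x_j(z)x_j(w)$, $\square=-\Delta_t+\Delta_x$. Let $p>1$, $\mu\in\mathbb R\setminus\{0\}$, $0\le k\le s$, $0\le n\le m-s$, and $\ell_{k,n}(z)=-\sum_{i\le k}t_i^2+\sum_{j\le n}x_j^2$. The function $\varphi$ is $\ell_{k,n}$ if $k+n>0$; if $k=n=0$, it is either $\langle a,\cdot\rangle$ with $a\neq 0$, or $\sum_{i=1}^s(t_i-\epsilon_ix_i)^2+2\sum_{j=s+1}^{s+\omega}x_j$ with $\epsilon_i\in\{\pm1\}$ and $1\le\omega\le m-2s$. Let $u=v\circ\varphi$ be a solution of $-\square u=\mu|u|^{p-1}u$ on $\Omega=\varphi^{-1}(I)$, where $I$ is an open interval containing $0$ and $v\in C^2(I)$, $v(0)>0$. With $N=k+n$ (and $\frac{N+2}{N-2}=\infty$ for $N=2$), consider the following cases. - (Y1) $N\le 1$ and $I=\mathbb R$. - (Y2) $N\ge2$,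 $k=0$ or $n=0$, $p<\frac{N+2}{N-2}$, $I=\mathbb R$. - (Y3) $N>2$, $k=0$ or $n=0$, $p\ge\frac{N+2}{N-2}$, $I=\mathbb R$. - (Y4) $k=0$ or $n=0$, and for some $R>0$: if $k=n=0$, then $I=(-R,R)$ and $|u|\to\infty$ as $\varphi\to\pm R$; if $k=0<n$, then $I=(-\infty,R)$ and $|u|\to\infty$ as $\varphi\to R$; if $n=0<k$, then $I=(-R,\infty)$ and $|u|\to\infty$ as $\varphi\to-R$. - (Y5), (Y6) $k,n\ne0$, and for some $R>0$ either $I=(-\infty,R)$ and $|u|\to\infty$ as $\varphi\to R$, or $I=(-R,\infty)$ and $|u|\to\infty$ as $\varphi\to-R$; in (Y5) $p<\frac{N+2}{N-2}$, in (Y6) $N>2$ and $p\ge\frac{N+2}{N-2}$. Below, $S$ denotes a connected component of a regular level set of $u$ or of the nodal set $\{u=0\}$, and $V$ a connected component of the critical set $\{\nabla u=0\}$, both in $\Omega$. The blow-up set consists of the points $z$ of $\overline\Omega$ at which $|u|\to\infty$ (as the argument tends to $z$ within $\Omega$). "Homothetic" means: equal to the image under a map $z\mapsto cLz+b$ with $c>0$,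 $L$ a linear isometry of $\mathbb R^m_s$, $b\in\mathbb R^m_s$. Models, as subsets of $\mathbb R^m_s$: $\mathcal L_a=\{\langle a,z\rangle=0\}$; $\mathbb R^{m-(k+n)}_{s-k}=\{t_1=\dots=t_k=0,\ x_1=\dots=x_n=0\}$; $\mathbb S_k^{k+n-1}(1)\times\mathbb R^{m-(k+n)}_{s-k}=\{\ell_{k,n}=1\}$, $\mathbb H_{k-1}^{k+n-1}(1)\times\mathbb R^{m-(k+n)}_{s-k}=\{\ell_{k,n}=-1\}$ and the null cone $\mathcal C_k^{k+n-1}\times\mathbb R^{m-(k+n)}_{s-k}=\{\ell_{k,n}=0\}$; $\mathbb R^{m-n}_s\times\mathbb S^{n-1}(1)=\{\ell_{0,n}=1\}$ and $\mathbb S^{k-1}(1)\times\mathbb R^{m-k}_{s-k}=\{\ell_{k,0}=-1\}$; a parabolic cylinder $\mathcal P\times\mathbb R^{m-2s-\omega}=\{\sum_{i=1}^s(t_i-\epsilon_ix_i)^2+2\sum_{j=s+1}^{s+\omega}x_j=0\}$. **Theorem.** 1. For (Y1) and (Y4) there is one model $M$ among $\mathbb R^{m-1}_s$, $\mathbb R^{m-1}_{s-1}$,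 a parabolic cylinder $\mathcal P\times\mathbb R^{m-2s-\omega}$, $\mathbb R^{m-n}_s\times\mathbb S^{n-1}(1)$ (if $n\ge2$), $\mathbb S^{k-1}(1)\times\mathbb R^{m-k}_{s-k}$ (if $k\ge2$), such that every $S$ is homothetic to $M$, and no $S$ is homothetic to a model of another of these five kinds. If $\varphi=\langle a,\cdot\rangle$, every $S$ is homothetic to $\mathcal L_a$. Every $V$ is homothetic to $M$, or to the focal variety $\mathbb R^{m-n}_s$ (with $n>0$), or to $\mathbb R^{m-k}_{s-k}$ (with $k>0$). For (Y4) the blow-up set is nonempty, and each of its connected components is homothetic to $M$ and to every $S$. 2. For (Y2) and (Y3) the same statements about $S$ and $V$ hold, with $M$ not a parabolic cylinder. 3. For (Y5) and (Y6) every $S$ is homothetic to a connected component of $\mathbb S_k^{k+n-1}(1)\times\mathbb R^{m-(k+n)}_{s-k}$ or of $\mathbb H_{k-1}^{k+n-1}(1)\times\mathbb R^{m-(k+n)}_{s-k}$, and both options occur. Every $V$ is homothetic to a connected component of one of these two or equals the subspace $\mathbb R^{m-(k+n)}_{s-k}$ (the singular set of the null cone), which does occur. Every connected component of a level set of $u$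 that contains a critical point of $u$ is homothetic to a connected component of one of these two or to the null cone $\mathcal C_k^{k+n-1}\times\mathbb R^{m-(k+n)}_{s-k}$, and the null cone is a connected component of the level set $\{u=u(0)\}$. The blow-up set is nonempty, and each of its connected components is homothetic to some $S$. -/

import Mathlib

open Set Filter Topology

noncomputable section

/-- The semi-Euclidean space `ℝ^m_s` with `m = s + r`: a point is `z = (t, x)`, where `t` collects
the `s` time variables and `x` the `r = m - s` space variables. -/
abbrev SemiEuclid (s r : ℕ) : Type := (Fin s → ℝ) × (Fin r → ℝ)

namespace SemiEuclid

variable {s r : ℕ}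

/-- The scalar product `⟨z, w⟩ = -∑ tᵢ(z) tᵢ(w) + ∑ xⱼ(z) xⱼ(w)`. -/
def form (z w : SemiEuclid s r) : ℝ :=
  -(∑ i, z.1 i * w.1 i) + ∑ j, z.2 j * w.2 j

/-- The d'Alembertian `□ = div ∘ grad = -Δ_t + Δ_x`. -/
def dAlembertian (u : SemiEuclid s r → ℝ) (z : SemiEuclid s r) : ℝ :=
  -(∑ i : Fin s, iteratedFDeriv ℝ 2 u z
      ![((Pi.single i (1 : ℝ), 0) : SemiEuclid s r), ((Pi.single i (1 : ℝ), 0) : SemiEuclid s r)])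
  + ∑ j : Fin r, iteratedFDeriv ℝ 2 u z
      ![((0, Pi.single j (1 : ℝ)) : SemiEuclid s r), ((0, Pi.single j (1 : ℝ)) : SemiEuclid s r)]

/-- `A` is homothetic to `B` up to isometries of `ℝ^m_s`: `A` is the image of `B` under a map
`z ↦ c L z + b` with `c > 0`, `L` a linear isometry of the scalar product and `b` a vector. -/
def Homothetic (A B : Set (SemiEuclid s r)) : Prop :=
  ∃ (c : ℝ) (L : SemiEuclid s r ≃ₗ[ℝ] SemiEuclid s r) (b : SemiEuclid s r),
    0 < c ∧ (∀ z w, form (L z) (L w) = form z w) ∧ A = (fun z => c • L z + b) '' B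

/-- `A` is a connected component of the set `F`. -/
def IsComponent (A F : Set (SemiEuclid s r)) : Prop :=
  ∃ z ∈ F, A = connectedComponentIn F z

/-- `A` is homothetic, up to isometries, to a connected component of `B`. -/
def HomotheticToComponent (A B : Set (SemiEuclid s r)) : Prop :=
  ∃ C, IsComponent C B ∧ Homothetic A C

/-! ### The functions whose level sets are used -/

/-- `ℓ_{k,n}(z) = -(t₁² + ⋯ + t_k²) + (x₁² + ⋯ + x_n²)`. -/
def ell (k n : ℕ) (z : SemiEuclid s r) : ℝ :=
  -(∑ i : Fin s, if (i : ℕ) < k then z.1 i ^ 2 else 0)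
  + ∑ j : Fin r, if (j : ℕ) < n then z.2 j ^ 2 else 0

/-- `∑_{i=1}^s (tᵢ - εᵢ xᵢ)² + 2 ∑_{j=s+1}^{s+ω} xⱼ`, for `s + ω ≤ m - s`. -/
def parabolicFun {ω : ℕ} (h : s + ω ≤ r) (ε : Fin s → ℝ) (z : SemiEuclid s r) : ℝ :=
  (∑ i : Fin s, (z.1 i - ε i * z.2 (Fin.castLE (le_trans (Nat.le_add_right s ω) h) i)) ^ 2)
  + 2 * ∑ j : Fin ω, z.2 (Fin.castLE h (Fin.natAdd s j))

/-- `φ` is one of the functions belonging to `(k, n)`: for `k = n = 0` a nonzero linear function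
`⟨a, ·⟩` or the function of a parabolic cylinder, and for `k + n > 0` the function `ℓ_{k,n}`. -/
def IsGenerator (k n : ℕ) (φ : SemiEuclid s r → ℝ) : Prop :=
  (k = 0 ∧ n = 0 ∧ ∃ a : SemiEuclid s r, a ≠ 0 ∧ φ = form a) ∨
  (k = 0 ∧ n = 0 ∧ ∃ (ω : ℕ) (h : s + ω ≤ r) (ε : Fin s → ℝ),
    1 ≤ ω ∧ (∀ i, ε i = 1 ∨ ε i = -1) ∧ φ = parabolicFun h ε) ∨
  (0 < k + n ∧ φ = ell k n)

/-! ### The solutions -/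

/-- `u` solves `-□u = μ |u|^{p-1} u` on the domain `{z | φ z ∈ I}` and has there the form
`u = v ∘ φ` with a profile `v` of class `C²` and `v 0 > 0`.
(Only the values of `v` on `I ∩ range φ` matter; if `range φ` is a half-line ending at `0`, a `C²`
function up to the end point extends to a `C²` function across it.) -/
def IsSolutionThrough (μ p : ℝ) (φ : SemiEuclid s r → ℝ) (I : Set ℝ)
    (u : SemiEuclid s r → ℝ) : Prop :=
  (∃ v : ℝ → ℝ, 0 < v 0 ∧ ContDiffOn ℝ 2 v I ∧ ∀ z ∈ φ ⁻¹' I, u z = v (φ z)) ∧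
  ∀ z ∈ φ ⁻¹' I, -(dAlembertian u z) = μ * (|u z| ^ (p - 1) * u z)

/-- `|u(z)| → ∞` as `φ(z) → R` within the domain `{z | φ z ∈ I}`. -/
def BlowsUpAs (φ : SemiEuclid s r → ℝ) (I : Set ℝ) (u : SemiEuclid s r → ℝ) (R : ℝ) : Prop :=
  Tendsto (fun z => |u z|) (comap φ (𝓝 R) ⊓ 𝓟 (φ ⁻¹' I)) atTop

/-- (Y1): global solutions, `k + n = 0, 1`. -/
def IsY1 (k n : ℕ) (μ p : ℝ) (φ : SemiEuclid s r → ℝ) (I : Set ℝ)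
    (u : SemiEuclid s r → ℝ) : Prop :=
  k + n ≤ 1 ∧ IsGenerator k n φ ∧ I = univ ∧ IsSolutionThrough μ p φ I u

/-- (Y2): global solutions, `k + n ≥ 2`, `k = 0` or `n = 0`, subcritical exponent. -/
def IsY2 (k n : ℕ) (μ p : ℝ) (φ : SemiEuclid s r → ℝ) (I : Set ℝ)
    (u : SemiEuclid s r → ℝ) : Prop :=
  2 ≤ k + n ∧ (k = 0 ∨ n = 0) ∧ (k + n = 2 ∨ p < ((k : ℝ) + n + 2) / ((k : ℝ) + n - 2)) ∧
  IsGenerator k n φ ∧ I = univ ∧ IsSolutionThrough μ p φ I u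

/-- (Y3): global solutions, `k + n > 2`, `k = 0` or `n = 0`, critical or supercritical exponent. -/
def IsY3 (k n : ℕ) (μ p : ℝ) (φ : SemiEuclid s r → ℝ) (I : Set ℝ)
    (u : SemiEuclid s r → ℝ) : Prop :=
  2 < k + n ∧ (k = 0 ∨ n = 0) ∧ ((k : ℝ) + n + 2) / ((k : ℝ) + n - 2) ≤ p ∧
  IsGenerator k n φ ∧ I = univ ∧ IsSolutionThrough μ p φ I u

/-- (Y4): blowing-up solutions with `k = 0` or `n = 0`. For `k = n = 0` the solution lives on
`{-R < φ < R}` and `|u| → ∞` as `φ → ±R`; for `k = 0 < n` on `{ℓ_{0,n} < R}` with `|u| → ∞` as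
`ℓ_{0,n} → R`; for `n = 0 < k` on `{ℓ_{k,0} > -R}` with `|u| → ∞` as `ℓ_{k,0} → -R`. -/
def IsY4 (k n : ℕ) (μ p : ℝ) (φ : SemiEuclid s r → ℝ) (I : Set ℝ)
    (u : SemiEuclid s r → ℝ) : Prop :=
  IsGenerator k n φ ∧ IsSolutionThrough μ p φ I u ∧ ∃ R : ℝ, 0 < R ∧
    ((k = 0 ∧ n = 0 ∧ I = Ioo (-R) R ∧ BlowsUpAs φ I u R ∧ BlowsUpAs φ I u (-R)) ∨
     (k = 0 ∧ 0 < n ∧ I = Iio R ∧ BlowsUpAs φ I u R) ∨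
     (0 < k ∧ n = 0 ∧ I = Ioi (-R) ∧ BlowsUpAs φ I u (-R)))

/-- The common part of (Y5) and (Y6): `k, n ≠ 0`, and either the solution lives on `{ℓ_{k,n} < R}`
with `|u| → ∞` as `ℓ_{k,n} → R`, or on `{ℓ_{k,n} > -R}` with `|u| → ∞` as `ℓ_{k,n} → -R`. -/
def IsMixedBlowUp (k n : ℕ) (μ p : ℝ) (φ : SemiEuclid s r → ℝ) (I : Set ℝ)
    (u : SemiEuclid s r → ℝ) : Prop :=
  0 < k ∧ 0 < n ∧ IsGenerator k n φ ∧ IsSolutionThrough μ p φ I u ∧ ∃ R : ℝ, 0 < R ∧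
    ((I = Iio R ∧ BlowsUpAs φ I u R) ∨ (I = Ioi (-R) ∧ BlowsUpAs φ I u (-R)))

/-- (Y5): subcritical exponent. -/
def IsY5 (k n : ℕ) (μ p : ℝ) (φ : SemiEuclid s r → ℝ) (I : Set ℝ)
    (u : SemiEuclid s r → ℝ) : Prop :=
  (k + n = 2 ∨ p < ((k : ℝ) + n + 2) / ((k : ℝ) + n - 2)) ∧ IsMixedBlowUp k n μ p φ I u

/-- (Y6): critical or supercritical exponent. -/
def IsY6 (k n : ℕ) (μ p : ℝ) (φ : SemiEuclid s r → ℝ) (I : Set ℝ)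
    (u : SemiEuclid s r → ℝ) : Prop :=
  2 < k + n ∧ ((k : ℝ) + n + 2) / ((k : ℝ) + n - 2) ≤ p ∧ IsMixedBlowUp k n μ p φ I u

/-! ### Level sets, critical set, blow-up set of a function `u` on a domain `Ω` -/

/-- The level set `{u = c}` in `Ω`. -/
def levelSet (u : SemiEuclid s r → ℝ) (Ω : Set (SemiEuclid s r)) (c : ℝ) :
    Set (SemiEuclid s r) := {z | z ∈ Ω ∧ u z = c}

/-- The critical set `{∇u = 0}` in `Ω`. -/
def criticalSet (u : SemiEuclid s r → ℝ) (Ω : Set (SemiEuclid s r)) : Set (SemiEuclid s r) :=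
  {z | z ∈ Ω ∧ fderiv ℝ u z = 0}

/-- `S` is a connected component of a regular level set of `u` or of the nodal set `{u = 0}`. -/
def IsRegularComponent (u : SemiEuclid s r → ℝ) (Ω S : Set (SemiEuclid s r)) : Prop :=
  ∃ c : ℝ, ((∀ z ∈ levelSet u Ω c, z ∉ criticalSet u Ω) ∨ c = 0) ∧ IsComponent S (levelSet u Ω c)

/-- The set on which `u` blows up: the points of the closure of `Ω` at which `|u| → ∞`. -/
def blowUpSet (u : SemiEuclid s r → ℝ) (Ω : Set (SemiEuclid s r)) : Set (SemiEuclid s r) :=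
  {z | z ∈ closure Ω ∧ Tendsto (fun w => |u w|) (𝓝[Ω] z) atTop}

/-! ### The model hypersurfaces and focal varieties, as subsets of `ℝ^m_s` -/

/-- `ℝ^{m-(k+n)}_{s-k}`, as the subspace `t₁ = ⋯ = t_k = 0`, `x₁ = ⋯ = x_n = 0`. -/
def flat (k n : ℕ) : Set (SemiEuclid s r) :=
  {z | (∀ i : Fin s, (i : ℕ) < k → z.1 i = 0) ∧ (∀ j : Fin r, (j : ℕ) < n → z.2 j = 0)}

/-- The hyperplane `ℒ_a = {z | ⟨a, z⟩ = 0}`. -/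
def hyperplane (a : SemiEuclid s r) : Set (SemiEuclid s r) := {z | form a z = 0}

/-- `𝕊_k^{(k+n)-1}(1) × ℝ^{m-(k+n)}_{s-k}`; for `k = 0` it is `𝕊^{n-1}(1) × ℝ^{m-n}_s`. -/
def pseudosphere (k n : ℕ) : Set (SemiEuclid s r) := {z | ell k n z = 1}

/-- `ℍ_{k-1}^{(k+n)-1}(1) × ℝ^{m-(k+n)}_{s-k}`; for `n = 0` it is `𝕊^{k-1}(1) × ℝ^{m-k}_{s-k}`. -/
def pseudohyperbolic (k n : ℕ) : Set (SemiEuclid s r) := {z | ell k n z = -1}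

/-- The null cone `𝒞_k^{(k+n)-1} × ℝ^{m-(k+n)}_{s-k}`. -/
def nullCone (k n : ℕ) : Set (SemiEuclid s r) := {z | ell k n z = 0}

/-- `P` is a parabolic cylinder `𝒫 × ℝ^{m-2s-ω}` (just `𝒫` if `ω = m - 2s`). -/
def IsParabolicCylinder (P : Set (SemiEuclid s r)) : Prop :=
  ∃ (ω : ℕ) (h : s + ω ≤ r) (ε : Fin s → ℝ),
    1 ≤ ω ∧ (∀ i, ε i = 1 ∨ ε i = -1) ∧ P = {z | parabolicFun h ε z = 0}

/-- The different shapes of level hypersurfaces if `k = 0` or `n = 0`. -/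
inductive Shape : Type
  | flatSpace : Shape
  | flatTime : Shape
  | sphereSpace : Shape
  | sphereTime : Shape
  | parabolic : Shape

/-- `M` is a model of the given shape: `ℝ^{m-1}_s`, `ℝ^{m-1}_{s-1}`, `ℝ^{m-n}_s × 𝕊^{n-1}(1)`
(for `n ≥ 2`), `𝕊^{k-1}(1) × ℝ^{m-k}_{s-k}` (for `k ≥ 2`), a parabolic cylinder. -/
def IsModel (k n : ℕ) : Shape → Set (SemiEuclid s r) → Prop
  | Shape.flatSpace, M => M = flat 0 1
  | Shape.flatTime, M => M = flat 1 0
  | Shape.sphereSpace, M => 2 ≤ n ∧ M = pseudosphere 0 n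
  | Shape.sphereTime, M => 2 ≤ k ∧ M = pseudohyperbolic k 0
  | Shape.parabolic, M => IsParabolicCylinder M

/-- All regular level hypersurfaces of `u` in `Ω` (and the nodal set) have connected components
homothetic to one and the same model `M` of shape `σ`, and no model of another shape is possible. -/
def HasUniqueShape (k n : ℕ) (u : SemiEuclid s r → ℝ) (Ω : Set (SemiEuclid s r))
    (σ : Shape) (M : Set (SemiEuclid s r)) : Prop :=
  IsModel k n σ M ∧ (∀ S, IsRegularComponent u Ω S → Homothetic S M) ∧
  ∀ (σ' : Shape) (M' S : Set (SemiEuclid s r)),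
    IsModel k n σ' M' → IsRegularComponent u Ω S → Homothetic S M' → σ' = σ

/-- Every connected component `V` of the critical set is homothetic to `M` or to a focal variety
`ℝ^{m-n}_s` (for `n > 0`) or `ℝ^{m-k}_{s-k}` (for `k > 0`). -/
def CriticalModelOrFocal (k n : ℕ) (u : SemiEuclid s r → ℝ) (Ω M : Set (SemiEuclid s r)) : Prop :=
  ∀ V, IsComponent V (criticalSet u Ω) →
    Homothetic V M ∨ (0 < n ∧ Homothetic V (flat 0 n)) ∨ (0 < k ∧ Homothetic V (flat k 0))

end SemiEuclid

end

/-! Substituting `u = v ∘ φ` turns the wave equation into an ordinary differential equation `A v'' +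
B v' = -μ|v|^(p-1) v` on `I ∩ range φ`. Here `A = ⟨a, a⟩` or `4ω` and `B = 0` for the linear and
parabolic generators, while `A = 4y` and `B = 2(k+n)` for `ell k n`. The equation is singular at
most at `y = 0`, so vanishing Cauchy data at some `b ≠ 0` would propagate to `v 0 = 0`
(`IsProfile.eq_zero_of_initial`), against `v 0 > 0`. On an interval of constancy the equation forces
`v = 0`; hence `v` is constant on no interval (`IsProfile.nowhereConstant`), and its level sets and
the zeros of `v'` are totally disconnected.

Consequently `φ` is constant on every component of a level set or of the critical set of `u`
(`connectedComponentIn_eq_inter_fiber`), and the problem reduces to the fibers of `φ` and the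
critical points of `φ`. Fibers of a non-null linear form or of a parabolic generator are translates
of each other. For `k + n = 1` the function `ell k n` is plus or minus the square of a linear form,
which takes its place. Otherwise the homogeneity of `ell k n` makes fibers over levels of equal sign
homothetic. If `k = 0` or `n = 0`, only one sign occurs, and for `k + n ≥ 2` the fibers are
connected. If `k, n ≠ 0`, both signs occur, and a one-dimensional Sard argument
(`NowhereConstant.exists_regular_value`) yields regular levels on both sides of the null cone.

The fiber `ell k n = 0` carries the value `v 0 > 0` and contains the critical point `0`, so it is
neither regular nor nodal. There the equation reads `2(k+n) v'(0) = -μ v(0)^p`, so `v'(0) ≠ 0` and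
the critical points of `u` on the cone are those of `ell k n`. The blow-up set is the preimage of
the finite end points of `I`, again a union of fibers. The models are told apart by convexity,
central symmetry and the sign of the square of a normal vector. -/

noncomputable section

namespace SemiEuclid

variable {s r : ℕ}

/-! ### The scalar product -/

theorem form_comm (z w : SemiEuclid s r) : form z w = form w z := by
  simp only [form, mul_comm]

theorem form_add_left (z z' w : SemiEuclid s r) : form (z + z') w = form z w + form z' w := by
  simp only [form, Prod.fst_add, Prod.snd_add, Pi.add_apply, add_mul, Finset.sum_add_distrib]
  ring

theorem form_smul_left (c : ℝ) (z w : SemiEuclid s r) : form (c • z) w = c * form z w := by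
  simp only [form, Prod.smul_fst, Prod.smul_snd, Pi.smul_apply, smul_eq_mul, mul_assoc,
    ← Finset.mul_sum]
  ring

theorem form_add_right (z w w' : SemiEuclid s r) : form z (w + w') = form z w + form z w' := by
  rw [form_comm, form_add_left, form_comm w, form_comm w']

theorem form_smul_right (c : ℝ) (z w : SemiEuclid s r) : form z (c • w) = c * form z w := by
  rw [form_comm, form_smul_left, form_comm]

theorem form_neg_left (z w : SemiEuclid s r) : form (-z) w = -form z w := by
  rw [← neg_one_smul ℝ, form_smul_left]; ring

theorem form_sub_left (z z' w : SemiEuclid s r) : form (z - z') w = form z w - form z' w := by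
  rw [sub_eq_add_neg, form_add_left, form_neg_left]; ring

theorem form_sub_right (z w w' : SemiEuclid s r) : form z (w - w') = form z w - form z w' := by
  rw [form_comm, form_sub_left, form_comm w, form_comm w']

theorem form_zero_right (z : SemiEuclid s r) : form z 0 = 0 := by simp [form]

theorem continuous_form (a : SemiEuclid s r) : Continuous (form a) := by
  unfold form; fun_prop

/-! ### Homotheties -/

theorem Homothetic.refl (A : Set (SemiEuclid s r)) : Homothetic A A :=
  ⟨1, LinearEquiv.refl ℝ _, 0, one_pos, fun _ _ => rfl, by simp⟩

theorem Homothetic.symm {A B : Set (SemiEuclid s r)} (h : Homothetic A B) : Homothetic B A := by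
  obtain ⟨c, L, b, hc, hL, rfl⟩ := h
  refine ⟨c⁻¹, L.symm, -(c⁻¹ • L.symm b), inv_pos.2 hc, fun z w => ?_, ?_⟩
  · rw [← hL, L.apply_symm_apply, L.apply_symm_apply]
  · rw [image_image]
    have : ∀ z, c⁻¹ • L.symm (c • L z + b) + -(c⁻¹ • L.symm b) = z := fun z => by
      simp [smul_smul, hc.ne']
    simp only [this, image_id']

theorem Homothetic.trans {A B D : Set (SemiEuclid s r)} (h : Homothetic A B)
    (h' : Homothetic B D) : Homothetic A D := by
  obtain ⟨c, L, b, hc, hL, rfl⟩ := h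
  obtain ⟨c', L', b', hc', hL', rfl⟩ := h'
  refine ⟨c * c', L'.trans L, c • L b' + b, mul_pos hc hc', fun z w => ?_, ?_⟩
  · simp [hL, hL']
  · rw [image_image]
    congr 1
    funext z
    simp [smul_smul, add_assoc]

theorem homothetic_add (A : Set (SemiEuclid s r)) (b : SemiEuclid s r) :
    Homothetic ((fun z => z + b) '' A) A :=
  ⟨1, LinearEquiv.refl ℝ _, b, one_pos, fun _ _ => rfl, by simp⟩

theorem homothetic_smul (A : Set (SemiEuclid s r)) {c : ℝ} (hc : 0 < c) :
    Homothetic ((fun z => c • z) '' A) A :=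
  ⟨c, LinearEquiv.refl ℝ _, 0, hc, fun _ _ => rfl, by simp⟩

theorem homothetic_image (A : Set (SemiEuclid s r)) (L : SemiEuclid s r ≃ₗ[ℝ] SemiEuclid s r)
    (hL : ∀ z w, form (L z) (L w) = form z w) : Homothetic (L '' A) A :=
  ⟨1, L, 0, one_pos, hL, by simp⟩

/-- Convexity, like central symmetry below, is an affine invariant; these two properties separate
most of the models. -/
theorem Homothetic.convex {A B : Set (SemiEuclid s r)} (h : Homothetic A B) (hB : Convex ℝ B) :
    Convex ℝ A := by
  obtain ⟨c, L, d, -, -, rfl⟩ := h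
  rintro _ ⟨z, hz, rfl⟩ _ ⟨w, hw, rfl⟩ a b ha hb hab
  refine ⟨a • z + b • w, hB hz hw ha hb hab, ?_⟩
  have hd : d = a • d + b • d := by rw [← add_smul, hab, one_smul]
  simp only [map_add, map_smul]
  nth_rewrite 1 [hd]
  module

/-- Central symmetry of a set with respect to some point. -/
def CentrallySymmetric (A : Set (SemiEuclid s r)) : Prop :=
  ∃ b, ∀ z ∈ A, b - z ∈ A

theorem Homothetic.centrallySymmetric {A B : Set (SemiEuclid s r)} (h : Homothetic A B)
    (hB : CentrallySymmetric B) : CentrallySymmetric A := by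
  obtain ⟨c, L, b, -, -, rfl⟩ := h
  obtain ⟨d, hd⟩ := hB
  refine ⟨c • L d + (2 : ℝ) • b, ?_⟩
  rintro _ ⟨z, hz, rfl⟩
  refine ⟨d - z, hd z hz, ?_⟩
  simp only [map_sub, smul_sub, two_smul]
  abel

/-! ### Reflections and hyperplanes -/

/-- The reflection in the hyperplane orthogonal to a vector that is not null. -/
def reflectionMap (w : SemiEuclid s r) : SemiEuclid s r →ₗ[ℝ] SemiEuclid s r where
  toFun z := z - (2 * form z w / form w w) • w
  map_add' z z' := by
    rw [form_add_left, mul_add, add_div, add_smul]; abel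
  map_smul' c z := by
    rw [form_smul_left, RingHom.id_apply, smul_sub, smul_smul]
    congr 2; ring

theorem reflectionMap_apply (w z : SemiEuclid s r) :
    reflectionMap w z = z - (2 * form z w / form w w) • w := rfl

theorem form_reflectionMap {w : SemiEuclid s r} (hw : form w w ≠ 0) (z z' : SemiEuclid s r) :
    form (reflectionMap w z) (reflectionMap w z') = form z z' := by
  simp only [reflectionMap_apply, form_sub_left, form_sub_right, form_smul_left, form_smul_right,
    form_comm w z']
  field_simp
  ring

theorem reflectionMap_involutive {w : SemiEuclid s r} (hw : form w w ≠ 0) :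
    Function.Involutive (reflectionMap w) := fun z => by
  simp only [reflectionMap_apply, form_sub_left, form_smul_left, sub_sub, ← add_smul]
  rw [sub_eq_self]
  convert zero_smul ℝ w
  field_simp
  ring

/-- The squares of `a - b` and `a + b` add up to `4⟨a, a⟩ ≠ 0`, so at least one of these vectors is
not null. The reflection along it takes `a` to `b` or to `-b`; the sign is irrelevant for orthogonal
hyperplanes. -/
theorem exists_isometry_apply_eq {a b : SemiEuclid s r} (hab : form a a = form b b)
    (ha : form a a ≠ 0) : ∃ L : SemiEuclid s r ≃ₗ[ℝ] SemiEuclid s r,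
      (∀ z w, form (L z) (L w) = form z w) ∧ (L a = b ∨ L a = -b) := by
  have hba := form_comm b a
  by_cases h : form (a - b) (a - b) = 0
  · have h' : form (a + b) (a + b) ≠ 0 := by
      simp only [form_sub_left, form_sub_right, form_add_left, form_add_right] at h ⊢
      intro h'
      exact ha (by linarith)
    refine ⟨LinearEquiv.ofInvolutive _ (reflectionMap_involutive h'), form_reflectionMap h',
      Or.inr ?_⟩
    have : 2 * form a (a + b) / form (a + b) (a + b) = 1 := by
      rw [div_eq_one_iff_eq h']
      simp only [form_add_left, form_add_right]
      linarith
    change reflectionMap (a + b) a = -b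
    rw [reflectionMap_apply, this]
    simp
  · refine ⟨LinearEquiv.ofInvolutive _ (reflectionMap_involutive h), form_reflectionMap h,
      Or.inl ?_⟩
    have : 2 * form a (a - b) / form (a - b) (a - b) = 1 := by
      rw [div_eq_one_iff_eq h]
      simp only [form_sub_left, form_sub_right]
      linarith
    change reflectionMap (a - b) a = b
    rw [reflectionMap_apply, this]
    simp

theorem hyperplane_smul {c : ℝ} (hc : c ≠ 0) (a : SemiEuclid s r) :
    hyperplane (c • a) = hyperplane a := by
  ext z; simp [hyperplane, form_smul_left, hc]

theorem homothetic_hyperplane {a b : SemiEuclid s r} (hab : form a a = form b b)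
    (ha : form a a ≠ 0) : Homothetic (hyperplane a) (hyperplane b) := by
  obtain ⟨L, hL, h⟩ := exists_isometry_apply_eq hab ha
  have key : hyperplane (L a) = L '' hyperplane a := by
    ext z
    constructor
    · intro hz
      refine ⟨L.symm z, ?_, L.apply_symm_apply z⟩
      change form _ _ = 0
      rw [← hL, L.apply_symm_apply]; exact hz
    · rintro ⟨w, hw, rfl⟩
      change form _ _ = 0
      rw [hL]; exact hw
  have hb : hyperplane (L a) = hyperplane b := by
    rcases h with h | h
    · rw [h]
    · rw [h, ← neg_one_smul ℝ, hyperplane_smul (by norm_num)]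
  rw [← hb, key]
  exact (homothetic_image _ L hL).symm

/-- A coordinate vector of the space part. -/
def spaceVec (j : Fin r) : SemiEuclid s r := (0, Pi.single j 1)

/-- A coordinate vector of the time part. -/
def timeVec (i : Fin s) : SemiEuclid s r := (Pi.single i 1, 0)

theorem form_spaceVec (j : Fin r) (z : SemiEuclid s r) : form (spaceVec j) z = z.2 j := by
  simp [form, spaceVec, Pi.single_apply]

theorem form_timeVec (i : Fin s) (z : SemiEuclid s r) : form (timeVec i) z = -z.1 i := by
  simp [form, timeVec, Pi.single_apply]

theorem flat_zero_one (hr : 0 < r) :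
    (flat 0 1 : Set (SemiEuclid s r)) = hyperplane (spaceVec ⟨0, hr⟩) := by
  ext z
  simp only [flat, hyperplane, mem_ofPred_eq, form_spaceVec]
  constructor
  · intro h; exact h.2 _ (by simp)
  · intro h
    refine ⟨fun i hi => absurd hi (Nat.not_lt_zero _), fun j hj => ?_⟩
    have : j = ⟨0, hr⟩ := by ext; simpa using hj
    rw [this]; exact h

theorem flat_one_zero (hs : 0 < s) :
    (flat 1 0 : Set (SemiEuclid s r)) = hyperplane (timeVec ⟨0, hs⟩) := by
  ext z
  simp only [flat, hyperplane, mem_ofPred_eq, form_timeVec, neg_eq_zero]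
  constructor
  · intro h; exact h.1 _ (by simp)
  · intro h
    refine ⟨fun j hj => ?_, fun i hi => absurd hi (Nat.not_lt_zero _)⟩
    have : j = ⟨0, hs⟩ := by ext; simpa using hj
    rw [this]; exact h

theorem homothetic_hyperplane_flat_zero_one (hr : 0 < r) {a : SemiEuclid s r}
    (ha : 0 < form a a) : Homothetic (hyperplane a) (flat 0 1) := by
  rw [flat_zero_one hr, ← hyperplane_smul (inv_ne_zero (Real.sqrt_pos.2 ha).ne')]
  have h1 : form ((√(form a a))⁻¹ • a) ((√(form a a))⁻¹ • a) = 1 := by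
    rw [form_smul_left, form_smul_right]
    have := (Real.sqrt_pos.2 ha).ne'
    field_simp
    rw [Real.sq_sqrt ha.le]
  have h2 : form (spaceVec ⟨0, hr⟩ : SemiEuclid s r) (spaceVec ⟨0, hr⟩) = 1 := by
    rw [form_spaceVec]; simp [spaceVec]
  exact homothetic_hyperplane (h1.trans h2.symm) (by rw [h1]; exact one_ne_zero)

theorem homothetic_hyperplane_flat_one_zero (hs : 0 < s) {a : SemiEuclid s r}
    (ha : form a a < 0) : Homothetic (hyperplane a) (flat 1 0) := by
  have ha' : 0 < -form a a := by linarith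
  rw [flat_one_zero hs, ← hyperplane_smul (inv_ne_zero (Real.sqrt_pos.2 ha').ne')]
  have h1 : form ((√(-form a a))⁻¹ • a) ((√(-form a a))⁻¹ • a) = -1 := by
    rw [form_smul_left, form_smul_right]
    have := (Real.sqrt_pos.2 ha').ne'
    field_simp
    rw [Real.sq_sqrt ha'.le]
    ring
  have h2 : form (timeVec ⟨0, hs⟩ : SemiEuclid s r) (timeVec ⟨0, hs⟩) = -1 := by
    rw [form_timeVec]; simp [timeVec]
  exact homothetic_hyperplane (h1.trans h2.symm) (by rw [h1]; norm_num)

/-- A homothety would make the orthogonal complement of a timelike unit vector `f` orthogonal to a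
spacelike unit vector `g`, hence `g` proportional to `f`, which the signs of their squares forbid.
-/
theorem not_homothetic_flat (hs : 0 < s) (hr : 0 < r) :
    ¬ Homothetic (flat 0 1 : Set (SemiEuclid s r)) (flat 1 0) := by
  rw [flat_zero_one hr, flat_one_zero hs]
  rintro ⟨c, L, b, hc, hL, h⟩
  set e : SemiEuclid s r := spaceVec ⟨0, hr⟩ with he
  set f : SemiEuclid s r := timeVec ⟨0, hs⟩ with hf
  have hee : form e e = 1 := by rw [he, form_spaceVec]; simp [spaceVec]
  have hff : form f f = -1 := by rw [hf, form_timeVec]; simp [timeVec]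
  have hmem : ∀ w, form f w = 0 → form e (c • L w + b) = 0 := fun w hw => by
    have : c • L w + b ∈ hyperplane e := by rw [h]; exact ⟨w, hw, rfl⟩
    exact this
  have hb : form e b = 0 := by simpa using hmem 0 (form_zero_right f)
  have hw : ∀ w, form f w = 0 → form (L.symm e) w = 0 := fun w hw => by
    have := hmem w hw
    rw [form_add_right, hb, form_smul_right, add_zero] at this
    rw [← hL, L.apply_symm_apply]
    exact (mul_eq_zero.1 this).resolve_left hc.ne'
  set g := L.symm e with hg
  have hgg : form g g = 1 := by rw [← hL, hg, L.apply_symm_apply, hee]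
  -- The part of `g` orthogonal to `f`, the plus sign being due to `⟨f, f⟩ = -1`. Pairing it with
  -- `g` gives `1 + ⟨f, g⟩² = 0`.
  have h0 : form f (g + form f g • f) = 0 := by
    rw [form_add_right, form_smul_right, hff]; ring
  have h1 := hw _ h0
  rw [form_add_right, form_smul_right, hgg, form_comm g f] at h1
  nlinarith [sq_nonneg (form f g)]

/-! ### Sums of the first squares -/

theorem sum_ite_lt {q n : ℕ} (hn : n ≤ q) (f : Fin q → ℝ) :
    (∑ j : Fin q, if (j : ℕ) < n then f j else 0) = ∑ j : Fin n, f (Fin.castLE hn j) := by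
  obtain ⟨d, rfl⟩ := Nat.exists_eq_add_of_le hn
  rw [Fin.sum_univ_add]
  simp only [Fin.val_castAdd, Fin.is_lt, if_true, Fin.val_natAdd]
  have : ∀ i : Fin d, ¬ (n + (i : ℕ) < n) := fun i => by omega
  simp only [this, if_false, Finset.sum_const_zero, add_zero]
  rfl

theorem sum_ite_lt_eq_zero {q n : ℕ} (x : Fin q → ℝ) :
    (∑ j : Fin q, if (j : ℕ) < n then x j ^ 2 else 0) = 0 ↔ ∀ j : Fin q, (j : ℕ) < n → x j = 0 := by
  rw [Finset.sum_eq_zero_iff_of_nonneg]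
  · simp
  · intro i _; split_ifs <;> positivity

theorem sum_ite_lt_nonneg {q : ℕ} (n : ℕ) (x : Fin q → ℝ) :
    0 ≤ ∑ j : Fin q, if (j : ℕ) < n then x j ^ 2 else 0 :=
  Finset.sum_nonneg fun i _ => by split_ifs <;> positivity

/-- The set is a continuous image of a sphere of radius `√y` in dimension `n ≥ 2` times a full
space: the first `n` coordinates are read from the sphere and the others from the second factor,
whose own first `n` coordinates are ignored. -/
theorem isPreconnected_sum_sq_eq {q n : ℕ} (hn : n ≤ q) (h2 : 2 ≤ n) (y : ℝ) :
    IsPreconnected {x : Fin q → ℝ | (∑ j : Fin q, if (j : ℕ) < n then x j ^ 2 else 0) = y} := by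
  rcases lt_or_ge y 0 with hy | hy
  · convert isPreconnected_empty
    ext x
    simp only [mem_ofPred_eq, mem_empty_iff_false, iff_false]
    intro h
    linarith [sum_ite_lt_nonneg n x]
  have hsph : IsPreconnected (Metric.sphere (0 : EuclideanSpace ℝ (Fin n)) (√y)) := by
    apply isPreconnected_sphere
    rw [← Module.finrank_eq_rank, finrank_euclideanSpace_fin]
    exact_mod_cast h2
  have hprod := hsph.prod (isPreconnected_univ (α := Fin q → ℝ))
  let F : EuclideanSpace ℝ (Fin n) × (Fin q → ℝ) → Fin q → ℝ :=
    fun w j => if h : (j : ℕ) < n then w.1 ⟨j, h⟩ else w.2 j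
  have hF : Continuous F := by
    refine continuous_pi fun j => ?_
    by_cases h : (j : ℕ) < n
    · simp only [F, h, dif_pos]; fun_prop
    · simp only [F, h, dif_neg, not_false_eq_true]; fun_prop
  convert hprod.image F hF.continuousOn using 1
  ext x
  simp only [mem_ofPred_eq, sum_ite_lt hn]
  constructor
  · intro hx
    refine ⟨(WithLp.toLp 2 fun j => x (Fin.castLE hn j), x), ⟨?_, mem_univ _⟩, ?_⟩
    · simp [EuclideanSpace.norm_eq, hx]
    · funext j
      by_cases h : (j : ℕ) < n <;> simp [F, h]
  · rintro ⟨w, ⟨hw, -⟩, rfl⟩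
    rw [mem_sphere_zero_iff_norm, EuclideanSpace.norm_eq, Real.sqrt_inj (by positivity) hy] at hw
    rw [← hw]
    refine Finset.sum_congr rfl fun j _ => ?_
    simp [F]

/-! ### The quadratic functions `ell k n` -/

theorem continuous_ell (k n : ℕ) : Continuous (ell k n : SemiEuclid s r → ℝ) := by
  unfold ell
  refine Continuous.add (Continuous.neg (continuous_finsetSum _ fun i _ => ?_))
    (continuous_finsetSum _ fun i _ => ?_) <;> split_ifs <;> fun_prop

theorem ell_smul (k n : ℕ) (c : ℝ) (z : SemiEuclid s r) : ell k n (c • z) = c ^ 2 * ell k n z := by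
  simp only [ell, Prod.smul_fst, Prod.smul_snd, Pi.smul_apply, smul_eq_mul, mul_add, mul_neg,
    Finset.mul_sum, mul_pow, mul_ite, mul_zero]

theorem ell_zero_left (n : ℕ) (z : SemiEuclid s r) :
    ell 0 n z = ∑ j : Fin r, if (j : ℕ) < n then z.2 j ^ 2 else 0 := by
  simp [ell]

theorem ell_zero_right (k : ℕ) (z : SemiEuclid s r) :
    ell k 0 z = -∑ i : Fin s, if (i : ℕ) < k then z.1 i ^ 2 else 0 := by
  simp [ell]

theorem ell_zero_left_nonneg (n : ℕ) (z : SemiEuclid s r) : 0 ≤ ell 0 n z := by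
  rw [ell_zero_left]; exact sum_ite_lt_nonneg n z.2

theorem ell_zero_right_nonpos (k : ℕ) (z : SemiEuclid s r) : ell k 0 z ≤ 0 := by
  rw [ell_zero_right]; linarith [sum_ite_lt_nonneg k z.1]

theorem ell_zero_left_eq_zero (n : ℕ) : ell 0 n ⁻¹' {0} = (flat 0 n : Set (SemiEuclid s r)) := by
  ext z
  rw [mem_preimage, mem_singleton_iff, ell_zero_left, sum_ite_lt_eq_zero]
  simp [flat]

theorem ell_zero_right_eq_zero (k : ℕ) : ell k 0 ⁻¹' {0} = (flat k 0 : Set (SemiEuclid s r)) := by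
  ext z
  rw [mem_preimage, mem_singleton_iff, ell_zero_right, neg_eq_zero, sum_ite_lt_eq_zero]
  simp [flat]

theorem isPreconnected_ell_zero_left {n : ℕ} (hn : n ≤ r) (h2 : 2 ≤ n) (y : ℝ) :
    IsPreconnected (ell 0 n ⁻¹' {y} : Set (SemiEuclid s r)) := by
  convert (isPreconnected_univ (α := Fin s → ℝ)).prod (isPreconnected_sum_sq_eq hn h2 y) using 1
  ext z
  simp [ell_zero_left]

theorem isPreconnected_ell_zero_right {k : ℕ} (hk : k ≤ s) (h2 : 2 ≤ k) (y : ℝ) :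
    IsPreconnected (ell k 0 ⁻¹' {y} : Set (SemiEuclid s r)) := by
  convert (isPreconnected_sum_sq_eq hk h2 (-y)).prod (isPreconnected_univ (α := Fin r → ℝ)) using 1
  ext z
  simp [ell_zero_right, neg_eq_iff_eq_neg]

/-- Homogeneity of degree two. The condition `0 < y / y'` says that both levels are nonzero and of
equal sign, since division by zero gives zero; so only the sign of a nonzero level matters. -/
theorem ell_preimage_eq_smul (k n : ℕ) {y y' : ℝ} (h : 0 < y / y') :
    (ell k n ⁻¹' {y} : Set (SemiEuclid s r)) = (fun z => √(y / y') • z) '' (ell k n ⁻¹' {y'}) := by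
  have h0 := (Real.sqrt_pos.2 h).ne'
  have hy' : y' ≠ 0 := by rintro rfl; simp at h
  have hy : y ≠ 0 := by rintro rfl; simp at h
  ext z
  simp only [mem_preimage, mem_singleton_iff, mem_image]
  constructor
  · intro hz
    refine ⟨(√(y / y'))⁻¹ • z, ?_, by rw [smul_smul, mul_inv_cancel₀ h0, one_smul]⟩
    rw [ell_smul, inv_pow, Real.sq_sqrt h.le, hz]
    field_simp
  · rintro ⟨w, hw, rfl⟩
    rw [ell_smul, Real.sq_sqrt h.le, hw]
    field_simp

theorem homothetic_ell_preimage (k n : ℕ) {y y' : ℝ} (h : 0 < y / y') :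
    Homothetic (ell k n ⁻¹' {y} : Set (SemiEuclid s r)) (ell k n ⁻¹' {y'}) := by
  rw [ell_preimage_eq_smul k n h]
  exact homothetic_smul _ (Real.sqrt_pos.2 h)

/-- Scaling is a homeomorphism, so it matches components as well; this serves the indefinite case,
where fibers may be disconnected. -/
theorem connectedComponentIn_ell_preimage (k n : ℕ) {y y' : ℝ} (h : 0 < y / y')
    {z : SemiEuclid s r} (hz : ell k n z = y) :
    ∃ z', ell k n z' = y' ∧ Homothetic (connectedComponentIn (ell k n ⁻¹' {y}) z)
      (connectedComponentIn (ell k n ⁻¹' {y'}) z') := by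
  have h0 := Real.sqrt_pos.2 h
  have hz' : z ∈ (ell k n ⁻¹' {y} : Set (SemiEuclid s r)) := hz
  rw [ell_preimage_eq_smul k n h] at hz' ⊢
  obtain ⟨w, hw, rfl⟩ := hz'
  refine ⟨w, hw, ?_⟩
  have := (Homeomorph.smulOfNeZero (α := SemiEuclid s r) (√(y / y')) h0.ne').image_connectedComponentIn hw
  simp only [Homeomorph.smulOfNeZero_apply] at this
  rw [← this]
  exact homothetic_smul _ h0

theorem ell_spaceVec {k n : ℕ} (hr : 0 < r) (hn : 0 < n) :
    ell k n (spaceVec ⟨0, hr⟩ : SemiEuclid s r) = 1 := by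
  have : ∀ j : Fin r, (if (j : ℕ) < n then (Pi.single (⟨0, hr⟩ : Fin r) (1 : ℝ) : Fin r → ℝ) j ^ 2
      else 0) = if j = ⟨0, hr⟩ then 1 else 0 := fun j => by
    by_cases h : j = ⟨0, hr⟩
    · subst h; simp [hn]
    · simp [h]
  simp [ell, spaceVec, this]

theorem ell_timeVec {k n : ℕ} (hs : 0 < s) (hk : 0 < k) :
    ell k n (timeVec ⟨0, hs⟩ : SemiEuclid s r) = -1 := by
  have : ∀ j : Fin s, (if (j : ℕ) < k then (Pi.single (⟨0, hs⟩ : Fin s) (1 : ℝ) : Fin s → ℝ) j ^ 2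
      else 0) = if j = ⟨0, hs⟩ then 1 else 0 := fun j => by
    by_cases h : j = ⟨0, hs⟩
    · subst h; simp [hk]
    · simp [h]
  simp [ell, timeVec, this]

theorem exists_ell_eq_of_nonneg {k n : ℕ} (hr : 0 < r) (hn : 0 < n) {y : ℝ} (hy : 0 ≤ y) :
    ∃ z : SemiEuclid s r, ell k n z = y :=
  ⟨√y • spaceVec ⟨0, hr⟩, by rw [ell_smul, Real.sq_sqrt hy, ell_spaceVec hr hn, mul_one]⟩

theorem exists_ell_eq_of_nonpos {k n : ℕ} (hs : 0 < s) (hk : 0 < k) {y : ℝ} (hy : y ≤ 0) :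
    ∃ z : SemiEuclid s r, ell k n z = y :=
  ⟨√(-y) • timeVec ⟨0, hs⟩, by
    rw [ell_smul, Real.sq_sqrt (by linarith), ell_timeVec hs hk]; ring⟩

theorem ell_zero (k n : ℕ) : ell k n (0 : SemiEuclid s r) = 0 := by
  simpa using ell_smul k n 0 (0 : SemiEuclid s r)

theorem isPreconnected_nullCone (k n : ℕ) :
    IsPreconnected (nullCone k n : Set (SemiEuclid s r)) := by
  have : StarConvex ℝ 0 (nullCone k n : Set (SemiEuclid s r)) := by
    rw [starConvex_zero_iff]
    intro z hz a _ _
    change ell k n _ = 0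
    rw [ell_smul, show ell k n z = 0 from hz, mul_zero]
  refine (this.isPathConnected ?_).isConnected.isPreconnected
  exact ell_zero k n

theorem convex_flat (k n : ℕ) : Convex ℝ (flat k n : Set (SemiEuclid s r)) := by
  intro z hz w hw a b _ _ _
  exact ⟨fun i hi => by simp [hz.1 i hi, hw.1 i hi], fun j hj => by simp [hz.2 j hj, hw.2 j hj]⟩

theorem flat_subset_nullCone (k n : ℕ) : (flat k n : Set (SemiEuclid s r)) ⊆ nullCone k n := by
  intro z hz
  have h1 := (sum_ite_lt_eq_zero z.1).2 hz.1
  have h2 := (sum_ite_lt_eq_zero z.2).2 hz.2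
  simp [nullCone, ell, h1, h2]

/-! ### Distinguishing the models -/

/-- With `z` the level contains `-z`, but their midpoint `0` lies on level zero. -/
theorem not_convex_ell_preimage (k n : ℕ) {y : ℝ} (hy : y ≠ 0) {z : SemiEuclid s r}
    (hz : ell k n z = y) : ¬ Convex ℝ (ell k n ⁻¹' {y} : Set (SemiEuclid s r)) := by
  intro h
  have hz' : ell k n (-z) = y := by
    rw [← neg_one_smul ℝ, ell_smul, hz]; ring
  have := h hz hz' (show (0 : ℝ) ≤ 1 / 2 by norm_num) (show (0 : ℝ) ≤ 1 / 2 by norm_num)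
    (by norm_num)
  rw [mem_preimage, mem_singleton_iff, smul_neg, add_neg_cancel, ell_zero] at this
  exact hy this.symm

theorem centrallySymmetric_ell_preimage (k n : ℕ) (y : ℝ) :
    CentrallySymmetric (ell k n ⁻¹' {y} : Set (SemiEuclid s r)) := by
  refine ⟨0, fun z hz => ?_⟩
  rw [mem_preimage, mem_singleton_iff] at hz ⊢
  rw [zero_sub, ← neg_one_smul ℝ, ell_smul, hz]; ring

theorem centrallySymmetric_flat (k n : ℕ) :
    CentrallySymmetric (flat k n : Set (SemiEuclid s r)) :=
  ⟨0, fun z hz => ⟨fun i hi => by simp [hz.1 i hi], fun j hj => by simp [hz.2 j hj]⟩⟩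

/-- The cylinder contains the parabola `γ c` with `t₁ = c` and `x_{s+1} = -c²/2`. Along the
reflected curve `b - γ c` the defining function is a quadratic polynomial in `c` with leading
coefficient `2`, so it cannot vanish identically. -/
theorem IsParabolicCylinder.not_centrallySymmetric (hs : 0 < s) {P : Set (SemiEuclid s r)}
    (hP : IsParabolicCylinder P) : ¬ CentrallySymmetric P := by
  obtain ⟨ω, h, ε, hω, -, rfl⟩ := hP
  obtain ⟨d, rfl⟩ := Nat.exists_eq_add_of_le h
  rintro ⟨b, hb⟩
  let i₀ : Fin s := ⟨0, hs⟩
  let j₀ : Fin ω := ⟨0, hω⟩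
  let γ : ℝ → SemiEuclid s (s + ω + d) := fun c =>
    (Pi.single i₀ c, Pi.single (Fin.castLE h (Fin.natAdd s j₀)) (-(c ^ 2) / 2))
  have hi : ∀ i : Fin s, Fin.castLE (le_trans (Nat.le_add_right s ω) h) i ≠
      Fin.castLE h (Fin.natAdd s j₀) := fun i hij => by
    have := congrArg Fin.val hij
    simp at this
    omega
  have hj : ∀ j : Fin ω, (Fin.castLE h (Fin.natAdd s j) = Fin.castLE h (Fin.natAdd s j₀)) ↔
      j = j₀ := fun j => by
    simp [Fin.ext_iff]
  have key : ∀ (w : SemiEuclid s (s + ω + d)) (c : ℝ), parabolicFun h ε (w - γ c) =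
      parabolicFun h ε w - 2 * c * (w.1 i₀ - ε i₀ *
        w.2 (Fin.castLE (le_trans (Nat.le_add_right s ω) h) i₀)) + 2 * c ^ 2 := fun w c => by
    simp only [parabolicFun, γ, Prod.fst_sub, Prod.snd_sub, Pi.sub_apply, Pi.single_apply, hi,
      hj, if_false, sub_zero]
    rw [Finset.sum_sub_distrib, Finset.sum_ite_eq' Finset.univ j₀,
      ← Finset.add_sum_erase _ _ (Finset.mem_univ i₀),
      ← Finset.add_sum_erase _ (fun i => (w.1 i - ε i *
        w.2 (Fin.castLE (le_trans (Nat.le_add_right s ω) h) i)) ^ 2) (Finset.mem_univ i₀),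
      Finset.sum_congr rfl (fun i hi => by rw [if_neg (Finset.ne_of_mem_erase hi), sub_zero])]
    simp only [if_true, Finset.mem_univ]
    ring
  have hγ : ∀ c, parabolicFun h ε (γ c) = 0 := fun c => by
    have h0 := key (γ c) c
    have h1 : parabolicFun h ε (0 : SemiEuclid s (s + ω + d)) = 0 := by simp [parabolicFun]
    rw [sub_self, h1] at h0
    simp only [γ, Pi.single_apply, hi, if_true, if_false, mul_zero, sub_zero] at h0
    simp only [γ]
    linarith
  have hz := fun c => (key b c).symm.trans (hb (γ c) (hγ c))
  -- The second difference of the polynomial at `-1, 0, 1` equals `4`, while all three values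
  -- vanish.
  linarith [hz 0, hz 1, hz (-1)]

/-- Hyperplanes are convex and centrally symmetric, spherical cylinders symmetric but not convex,
parabolic cylinders not symmetric. The two hyperplanes differ by the causal character of the normal,
and the two spherical shapes exclude each other because `k = 0` or `n = 0`. -/
theorem IsModel.shape_unique {k n : ℕ} (hs : 0 < s) (hr : 0 < r) (hkn : k = 0 ∨ n = 0)
    {σ σ' : Shape} {M M' : Set (SemiEuclid s r)} (hM : IsModel k n σ M) (hM' : IsModel k n σ' M')
    (h : Homothetic M M') : σ' = σ := by
  have sphS : ∀ {A : Set (SemiEuclid s r)}, IsModel k n Shape.sphereSpace A →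
      ¬ Convex ℝ A ∧ CentrallySymmetric A := by
    rintro _ ⟨h, rfl⟩
    exact ⟨not_convex_ell_preimage 0 n one_ne_zero (ell_spaceVec hr (by omega)),
      centrallySymmetric_ell_preimage 0 n 1⟩
  have sphT : ∀ {A : Set (SemiEuclid s r)}, IsModel k n Shape.sphereTime A →
      ¬ Convex ℝ A ∧ CentrallySymmetric A := by
    rintro _ ⟨h, rfl⟩
    exact ⟨not_convex_ell_preimage k 0 (by norm_num) (ell_timeVec hs (by omega)),
      centrallySymmetric_ell_preimage k 0 (-1)⟩
  have flatS : ∀ {A : Set (SemiEuclid s r)}, IsModel k n Shape.flatSpace A →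
      Convex ℝ A ∧ CentrallySymmetric A := by
    rintro _ rfl
    exact ⟨convex_flat 0 1, centrallySymmetric_flat 0 1⟩
  have flatT : ∀ {A : Set (SemiEuclid s r)}, IsModel k n Shape.flatTime A →
      Convex ℝ A ∧ CentrallySymmetric A := by
    rintro _ rfl
    exact ⟨convex_flat 1 0, centrallySymmetric_flat 1 0⟩
  have par : ∀ {A : Set (SemiEuclid s r)}, IsModel k n Shape.parabolic A →
      ¬ CentrallySymmetric A := fun hA => IsParabolicCylinder.not_centrallySymmetric hs hA
  have sph : ∀ {A B : Set (SemiEuclid s r)}, IsModel k n Shape.sphereSpace A →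
      IsModel k n Shape.sphereTime B → False := by
    rintro _ _ ⟨h, -⟩ ⟨h', -⟩; omega
  have fl : ∀ {A B : Set (SemiEuclid s r)}, IsModel k n Shape.flatSpace A →
      IsModel k n Shape.flatTime B → ¬ Homothetic A B := by
    rintro _ _ rfl rfl; exact not_homothetic_flat hs hr
  have hc := h.convex
  have hc' := h.symm.convex
  have hp := h.centrallySymmetric
  have hp' := h.symm.centrallySymmetric
  cases σ <;> cases σ' <;> first | rfl | exfalso
  · exact fl hM hM' h
  · exact (sphS hM').1 (hc' (flatS hM).1)
  · exact (sphT hM').1 (hc' (flatS hM).1)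
  · exact par hM' (hp' (flatS hM).2)
  · exact fl hM' hM h.symm
  · exact (sphS hM').1 (hc' (flatT hM).1)
  · exact (sphT hM').1 (hc' (flatT hM).1)
  · exact par hM' (hp' (flatT hM).2)
  · exact (sphS hM).1 (hc (flatS hM').1)
  · exact (sphS hM).1 (hc (flatT hM').1)
  · exact sph hM hM'
  · exact par hM' (hp' (sphS hM).2)
  · exact (sphT hM).1 (hc (flatS hM').1)
  · exact (sphT hM).1 (hc (flatT hM').1)
  · exact sph hM' hM
  · exact par hM' (hp' (sphT hM).2)
  · exact par hM (hp (flatS hM').2)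
  · exact par hM (hp (flatT hM').2)
  · exact par hM (hp (sphS hM').2)
  · exact par hM (hp (sphT hM').2)

/-! ### Derivatives along lines -/

theorem hasDerivAt_quadratic (a b c l : ℝ) :
    HasDerivAt (fun l : ℝ => a + b * l + c * l ^ 2) (b + 2 * c * l) l := by
  have h1 := ((hasDerivAt_id l).const_mul b).const_add a
  have h2 := ((hasDerivAt_id l).pow 2).const_mul c
  refine (h1.add h2).congr_deriv ?_
  simp only [id]
  push_cast
  ring

section Line

variable {E : Type*} [NormedAddCommGroup E] [NormedSpace ℝ E] {φ : E → ℝ} {z e : E} {b c : ℝ}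

theorem fderiv_apply_of_line (hφ : DifferentiableAt ℝ φ z)
    (h : ∀ l : ℝ, φ (z + l • e) = φ z + b * l + c * l ^ 2) : fderiv ℝ φ z e = b := by
  have h1 : HasDerivAt (fun l : ℝ => z + l • e) e 0 := by
    simpa using ((hasDerivAt_id (0 : ℝ)).smul_const e).const_add z
  have h2 : HasDerivAt (fun l : ℝ => φ (z + l • e)) (fderiv ℝ φ z e) 0 :=
    HasFDerivAt.comp_hasDerivAt (x := (0 : ℝ)) (f := fun l : ℝ => z + l • e)
      (l := φ) (by simpa using hφ.hasFDerivAt) h1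
  simp only [h] at h2
  simpa using h2.unique (hasDerivAt_quadratic (φ z) b c 0)

/-- Every generator is a polynomial of degree at most two, so it is quadratic along each line. Hence
the pure second derivatives of `v ∘ φ`, the only ones in the d'Alembertian, follow from one-variable
calculus. -/
theorem iteratedFDeriv_two_of_line {u : E → ℝ} {v : ℝ → ℝ} {I : Set ℝ} (hI : IsOpen I)
    (hv : ContDiffOn ℝ 2 v I) (hφ : ContDiff ℝ 2 φ) (hu : ∀ z ∈ φ ⁻¹' I, u z = v (φ z))
    (hz : φ z ∈ I) (h : ∀ l : ℝ, φ (z + l • e) = φ z + b * l + c * l ^ 2) :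
    iteratedFDeriv ℝ 2 u z ![e, e] =
      deriv (deriv v) (φ z) * b ^ 2 + deriv v (φ z) * (2 * c) := by
  rw [iteratedFDeriv_two_apply]
  simp only [Matrix.cons_val_zero, Matrix.cons_val_one]
  have hΩ : IsOpen (φ ⁻¹' I) := hI.preimage hφ.continuous
  have hC : ContDiffOn ℝ 2 u (φ ⁻¹' I) :=
    (hv.comp hφ.contDiffOn (fun _ h => h)).congr hu
  have huz : ∀ w ∈ φ ⁻¹' I, DifferentiableAt ℝ u w := fun w hw =>
    (hC.contDiffAt (hΩ.mem_nhds hw)).differentiableAt (by norm_num)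
  have hdu : DifferentiableAt ℝ (fderiv ℝ u) z :=
    ((hC.contDiffAt (hΩ.mem_nhds hz)).fderiv_right (m := 1) (by norm_num)).differentiableAt
      (by norm_num)
  have hline : ∀ l : ℝ, HasDerivAt (fun l : ℝ => z + l • e) e l := fun l => by
    simpa using ((hasDerivAt_id l).smul_const e).const_add z
  have hnear : ∀ᶠ l : ℝ in 𝓝 0, z + l • e ∈ φ ⁻¹' I := by
    refine (hline 0).continuousAt.eventually_mem (hΩ.mem_nhds ?_)
    simpa using hz
  have hvd : ∀ y ∈ I, HasDerivAt v (deriv v y) y := fun y hy =>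
    ((hv.contDiffAt (hI.mem_nhds hy)).differentiableAt (by norm_num)).hasDerivAt
  have hvdd : HasDerivAt (deriv v) (deriv (deriv v) (φ z)) (φ z) :=
    (((hv.deriv_of_isOpen hI (m := 1) (by norm_num)).contDiffAt (hI.mem_nhds hz)).differentiableAt
      (by norm_num)).hasDerivAt
  have h1 : HasDerivAt (fun l : ℝ => fderiv ℝ u (z + l • e) e) (fderiv ℝ (fderiv ℝ u) z e e) 0 := by
    have := HasFDerivAt.comp_hasDerivAt (x := (0 : ℝ)) (f := fun l : ℝ => z + l • e)
      (l := fderiv ℝ u) (by simpa using hdu.hasFDerivAt) (hline 0)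
    exact ((ContinuousLinearMap.apply ℝ ℝ e).hasFDerivAt.comp_hasDerivAt (0 : ℝ) this)
  -- The identity `u = v ∘ φ` holds on the open domain only, so the derivatives along the line are
  -- compared for small `l`.
  have h2 : (fun l : ℝ => fderiv ℝ u (z + l • e) e) =ᶠ[𝓝 0]
      fun l => deriv v (φ z + b * l + c * l ^ 2) * (b + 2 * c * l) := by
    filter_upwards [hnear.eventually_nhds] with l hl
    have h3 : HasDerivAt (fun l : ℝ => u (z + l • e)) (fderiv ℝ u (z + l • e) e) l :=
      (huz _ hl.self_of_nhds).hasFDerivAt.comp_hasDerivAt l (hline l)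
    have h4 : HasDerivAt (fun l : ℝ => v (φ z + b * l + c * l ^ 2))
        (deriv v (φ z + b * l + c * l ^ 2) * (b + 2 * c * l)) l := by
      refine (hvd _ ?_).comp l (hasDerivAt_quadratic _ _ _ l)
      rw [← h]; exact hl.self_of_nhds
    refine h3.unique (h4.congr_of_eventuallyEq ?_)
    filter_upwards [hl] with l' hl'
    rw [hu _ hl', h]
  have h5 : HasDerivAt (fun l : ℝ => deriv v (φ z + b * l + c * l ^ 2) * (b + 2 * c * l))
      (deriv (deriv v) (φ z) * b ^ 2 + deriv v (φ z) * (2 * c)) 0 := by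
    have h6 : HasDerivAt (fun l : ℝ => deriv v (φ z + b * l + c * l ^ 2))
        (deriv (deriv v) (φ z) * (b + 2 * c * 0)) 0 :=
      HasDerivAt.comp (h₂ := deriv v) (0 : ℝ) (by simpa using hvdd)
        (hasDerivAt_quadratic (φ z) b c 0)
    have h7 : HasDerivAt (fun l : ℝ => b + 2 * c * l) (2 * c) 0 := by
      simpa using ((hasDerivAt_id (0 : ℝ)).const_mul (2 * c)).const_add b
    refine (h6.mul h7).congr_deriv ?_
    simp
    ring
  exact h1.unique (h5.congr_of_eventuallyEq h2)

end Line

/-! ### Expansions of the generating functions along lines -/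

/-- The symmetric bilinear form belonging to `ell k n`. -/
def ellForm (k n : ℕ) (z w : SemiEuclid s r) : ℝ :=
  -(∑ i : Fin s, if (i : ℕ) < k then z.1 i * w.1 i else 0)
  + ∑ j : Fin r, if (j : ℕ) < n then z.2 j * w.2 j else 0

theorem ell_add_smul (k n : ℕ) (z w : SemiEuclid s r) (l : ℝ) :
    ell k n (z + l • w) = ell k n z + 2 * ellForm k n z w * l + ell k n w * l ^ 2 := by
  have key : ∀ {q : ℕ} (m : ℕ) (x y : Fin q → ℝ),
      (∑ i : Fin q, if (i : ℕ) < m then (x i + l * y i) ^ 2 else 0) =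
      (∑ i : Fin q, if (i : ℕ) < m then x i ^ 2 else 0)
      + 2 * (∑ i : Fin q, if (i : ℕ) < m then x i * y i else 0) * l
      + (∑ i : Fin q, if (i : ℕ) < m then y i ^ 2 else 0) * l ^ 2 := by
    intro q m x y
    rw [Finset.mul_sum, Finset.sum_mul, Finset.sum_mul, ← Finset.sum_add_distrib,
      ← Finset.sum_add_distrib]
    refine Finset.sum_congr rfl fun i _ => ?_
    split_ifs <;> ring
  simp only [ell, ellForm, Prod.fst_add, Prod.snd_add, Prod.smul_fst, Prod.smul_snd, Pi.add_apply,
    Pi.smul_apply, smul_eq_mul, key]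
  ring

theorem ellForm_timeVec (k n : ℕ) (z : SemiEuclid s r) (i : Fin s) :
    ellForm k n z (timeVec i) = if (i : ℕ) < k then -z.1 i else 0 := by
  have : ∀ j : Fin s, (if (j : ℕ) < k then z.1 j * (Pi.single i (1 : ℝ) : Fin s → ℝ) j else 0) =
      if j = i then (if (i : ℕ) < k then z.1 i else 0) else 0 := fun j => by
    by_cases h : j = i
    · subst h; simp
    · simp [h]
  simp [ellForm, timeVec, this]
  split_ifs <;> simp

theorem ellForm_spaceVec (k n : ℕ) (z : SemiEuclid s r) (j : Fin r) :
    ellForm k n z (spaceVec j) = if (j : ℕ) < n then z.2 j else 0 := by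
  have : ∀ i : Fin r, (if (i : ℕ) < n then z.2 i * (Pi.single j (1 : ℝ) : Fin r → ℝ) i else 0) =
      if i = j then (if (j : ℕ) < n then z.2 j else 0) else 0 := fun i => by
    by_cases h : i = j
    · subst h; simp
    · simp [h]
  simp [ellForm, spaceVec, this]

theorem contDiff_ell (k n : ℕ) : ContDiff ℝ 2 (ell k n : SemiEuclid s r → ℝ) := by
  unfold ell
  refine ContDiff.add (ContDiff.neg (ContDiff.sum fun i _ => ?_))
    (ContDiff.sum fun i _ => ?_) <;> split_ifs <;> fun_prop

theorem fderiv_ell_eq_zero (k n : ℕ) (z : SemiEuclid s r) :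
    fderiv ℝ (ell k n) z = 0 ↔ z ∈ flat k n := by
  have h : ∀ w, fderiv ℝ (ell k n) z w = 2 * ellForm k n z w := fun w =>
    fderiv_apply_of_line ((contDiff_ell k n).differentiable (by norm_num) z)
      (ell_add_smul k n z w)
  constructor
  · intro h0
    refine ⟨fun i hi => ?_, fun j hj => ?_⟩
    · have := h (timeVec i)
      rw [h0, ellForm_timeVec, if_pos hi] at this
      simpa using this.symm
    · have := h (spaceVec j)
      rw [h0, ellForm_spaceVec, if_pos hj] at this
      simpa using this.symm
  · intro hz
    ext w
    all_goals
      simp only [ContinuousLinearMap.comp_apply, h]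
      have h1 : ∀ w : SemiEuclid s r, ellForm k n z w = 0 := fun w => by
        unfold ellForm
        rw [Finset.sum_eq_zero, Finset.sum_eq_zero]
        · simp
        · intro j _; split_ifs with hj
          · rw [hz.2 j hj, zero_mul]
          · rfl
        · intro j _; split_ifs with hj
          · rw [hz.1 j hj, zero_mul]
          · rfl
      simp [h1]

theorem parabolicFun_add_smul {ω : ℕ} (h : s + ω ≤ r) (ε : Fin s → ℝ) (z w : SemiEuclid s r)
    (l : ℝ) : parabolicFun h ε (z + l • w) = parabolicFun h ε z +
      2 * ((∑ i : Fin s, (z.1 i - ε i * z.2 (Fin.castLE (le_trans (Nat.le_add_right s ω) h) i)) *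
        (w.1 i - ε i * w.2 (Fin.castLE (le_trans (Nat.le_add_right s ω) h) i)))
        + ∑ j : Fin ω, w.2 (Fin.castLE h (Fin.natAdd s j))) * l +
      (∑ i : Fin s, (w.1 i - ε i * w.2 (Fin.castLE (le_trans (Nat.le_add_right s ω) h) i)) ^ 2)
        * l ^ 2 := by
  simp only [parabolicFun, Prod.fst_add, Prod.snd_add, Prod.smul_fst, Prod.smul_snd, Pi.add_apply,
    Pi.smul_apply, smul_eq_mul, Finset.sum_add_distrib, ← Finset.mul_sum]
  have : ∀ i : Fin s, (z.1 i + l * w.1 i - ε i *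
      (z.2 (Fin.castLE (le_trans (Nat.le_add_right s ω) h) i) +
        l * w.2 (Fin.castLE (le_trans (Nat.le_add_right s ω) h) i))) ^ 2 =
      (z.1 i - ε i * z.2 (Fin.castLE (le_trans (Nat.le_add_right s ω) h) i)) ^ 2 +
      (2 * l) * ((z.1 i - ε i * z.2 (Fin.castLE (le_trans (Nat.le_add_right s ω) h) i)) *
        (w.1 i - ε i * w.2 (Fin.castLE (le_trans (Nat.le_add_right s ω) h) i))) + l ^ 2 *
      (w.1 i - ε i * w.2 (Fin.castLE (le_trans (Nat.le_add_right s ω) h) i)) ^ 2 := fun i => by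
    ring
  simp only [this, Finset.sum_add_distrib, ← Finset.mul_sum]
  ring

theorem contDiff_parabolicFun {ω : ℕ} (h : s + ω ≤ r) (ε : Fin s → ℝ) :
    ContDiff ℝ 2 (parabolicFun h ε) := by
  unfold parabolicFun; fun_prop

theorem contDiff_form (a : SemiEuclid s r) : ContDiff ℝ 2 (form a) := by
  unfold form; fun_prop

/-! ### The d'Alembertian of a function of a generating function -/

section Wave

variable {φ u : SemiEuclid s r → ℝ} {v : ℝ → ℝ} {I : Set ℝ} {z : SemiEuclid s r}

theorem dAlembertian_comp_form (a : SemiEuclid s r) (hI : IsOpen I) (hv : ContDiffOn ℝ 2 v I)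
    (hu : ∀ z ∈ form a ⁻¹' I, u z = v (form a z)) (hz : form a z ∈ I) :
    dAlembertian u z = form a a * deriv (deriv v) (form a z) := by
  have hl : ∀ (e : SemiEuclid s r) (l : ℝ), form a (z + l • e) =
      form a z + form a e * l + 0 * l ^ 2 := fun e l => by
    rw [form_add_right, form_smul_right]; ring
  have h := fun e => iteratedFDeriv_two_of_line hI hv (contDiff_form a) hu hz (hl e)
  change -(∑ i : Fin s, iteratedFDeriv ℝ 2 u z ![timeVec i, timeVec i]) +
    ∑ j : Fin r, iteratedFDeriv ℝ 2 u z ![spaceVec j, spaceVec j] = _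
  simp only [h, form_comm a (timeVec _), form_comm a (spaceVec _), form_timeVec, form_spaceVec,
    mul_zero, add_zero, ← Finset.mul_sum]
  simp only [form, ← pow_two, neg_sq]
  ring

/-- The two terms come from `⟨∇ℓ, ∇ℓ⟩ = 4ℓ` and `□ℓ = 2(k+n)`: each of the `k` time directions
contributes `-(-2)`, each of the `n` space directions `2`. -/
theorem dAlembertian_comp_ell {k n : ℕ} (hk : k ≤ s) (hn : n ≤ r) (hI : IsOpen I)
    (hv : ContDiffOn ℝ 2 v I) (hu : ∀ z ∈ ell k n ⁻¹' I, u z = v (ell k n z))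
    (hz : ell k n z ∈ I) : dAlembertian u z =
      4 * ell k n z * deriv (deriv v) (ell k n z) + 2 * (k + n) * deriv v (ell k n z) := by
  have h := fun e => iteratedFDeriv_two_of_line hI hv (contDiff_ell k n) hu hz (ell_add_smul k n z e)
  -- Expanding `ell` at `e - e = 0` gives `ell e = ellForm e e`, which is already known on
  -- coordinate vectors.
  have ht : ∀ i : Fin s, ell k n (timeVec i : SemiEuclid s r) = if (i : ℕ) < k then -1 else 0 :=
    fun i => by
      have h1 := ell_add_smul k n (timeVec i : SemiEuclid s r) (timeVec i) (-1)
      have h2 := ellForm_timeVec k n (timeVec i : SemiEuclid s r) i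
      simp only [neg_smul, one_smul, add_neg_cancel, ell_zero] at h1
      simp only [timeVec, Pi.single_eq_same] at h2 h1 ⊢
      split_ifs at h2 ⊢ <;> linarith
  have hx : ∀ j : Fin r, ell k n (spaceVec j : SemiEuclid s r) = if (j : ℕ) < n then 1 else 0 :=
    fun i => by
      have h1 := ell_add_smul k n (spaceVec i : SemiEuclid s r) (spaceVec i) (-1)
      have h2 := ellForm_spaceVec k n (spaceVec i : SemiEuclid s r) i
      simp only [neg_smul, one_smul, add_neg_cancel, ell_zero] at h1
      simp only [spaceVec, Pi.single_eq_same] at h2 h1 ⊢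
      split_ifs at h2 ⊢ <;> linarith
  have hck : (∑ i : Fin s, if (i : ℕ) < k then (1 : ℝ) else 0) = k := by
    rw [sum_ite_lt hk]; simp
  have hcn : (∑ i : Fin r, if (i : ℕ) < n then (1 : ℝ) else 0) = n := by
    rw [sum_ite_lt hn]; simp
  change -(∑ i : Fin s, iteratedFDeriv ℝ 2 u z ![timeVec i, timeVec i]) +
    ∑ j : Fin r, iteratedFDeriv ℝ 2 u z ![spaceVec j, spaceVec j] = _
  simp only [h, ht, hx, ellForm_timeVec, ellForm_spaceVec]
  set y := ell k n z with hy
  have e1 : ∀ i : Fin s, deriv (deriv v) y * (2 * if (i : ℕ) < k then -z.1 i else 0) ^ 2 +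
      deriv v y * (2 * if (i : ℕ) < k then -1 else 0) =
      4 * deriv (deriv v) y * (if (i : ℕ) < k then z.1 i ^ 2 else 0) -
      2 * deriv v y * (if (i : ℕ) < k then 1 else 0) := fun i => by
    split_ifs <;> ring
  have e2 : ∀ i : Fin r, deriv (deriv v) y * (2 * if (i : ℕ) < n then z.2 i else 0) ^ 2 +
      deriv v y * (2 * if (i : ℕ) < n then 1 else 0) =
      4 * deriv (deriv v) y * (if (i : ℕ) < n then z.2 i ^ 2 else 0) +
      2 * deriv v y * (if (i : ℕ) < n then 1 else 0) := fun i => by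
    split_ifs <;> ring
  simp only [e1, e2, Finset.sum_add_distrib, Finset.sum_sub_distrib, ← Finset.mul_sum, hck, hcn]
  have : y = -(∑ i : Fin s, if (i : ℕ) < k then z.1 i ^ 2 else 0)
    + ∑ j : Fin r, if (j : ℕ) < n then z.2 j ^ 2 else 0 := rfl
  rw [show 4 * y * deriv (deriv v) y = 4 * deriv (deriv v) y * y by ring]
  conv_rhs => rw [show 4 * deriv (deriv v) y * y = 4 * deriv (deriv v) y *
    (-(∑ i : Fin s, if (i : ℕ) < k then z.1 i ^ 2 else 0)
    + ∑ j : Fin r, if (j : ℕ) < n then z.2 j ^ 2 else 0) from by rw [← this]]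
  ring

/-- Each square `(tᵢ - εᵢxᵢ)²` depends on a null direction because `εᵢ² = 1`, so its time and space
contributions cancel; each of the `ω` linear terms `2xⱼ` contributes `2² v''`. -/
theorem dAlembertian_comp_parabolicFun {ω : ℕ} (h : s + ω ≤ r) {ε : Fin s → ℝ}
    (hε : ∀ i, ε i = 1 ∨ ε i = -1) (hI : IsOpen I)
    (hv : ContDiffOn ℝ 2 v I) (hu : ∀ z ∈ parabolicFun h ε ⁻¹' I, u z = v (parabolicFun h ε z))
    (hz : parabolicFun h ε z ∈ I) : dAlembertian u z =
      4 * ω * deriv (deriv v) (parabolicFun h ε z) := by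
  obtain ⟨d, rfl⟩ := Nat.exists_eq_add_of_le h
  have hl := fun e => iteratedFDeriv_two_of_line hI hv (contDiff_parabolicFun h ε) hu hz
    (parabolicFun_add_smul h ε z e)
  have hε2 : ∀ i, ε i ^ 2 = 1 := fun i => by rcases hε i with h | h <;> rw [h] <;> norm_num
  change -(∑ i : Fin s, iteratedFDeriv ℝ 2 u z ![timeVec i, timeVec i]) +
    ∑ j : Fin (s + ω + d), iteratedFDeriv ℝ 2 u z ![spaceVec j, spaceVec j] = _
  simp only [hl]
  rw [Fin.sum_univ_add, Fin.sum_univ_add]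
  have hcast : ∀ i : Fin s, Fin.castLE (le_trans (Nat.le_add_right s ω) h) i =
      Fin.castAdd d (Fin.castAdd ω i) := fun i => rfl
  have hcast' : ∀ i : Fin (s + ω), Fin.castLE h i = Fin.castAdd d i := fun i => rfl
  have hne : ∀ (i : Fin s) (j : Fin ω), Fin.castAdd d (Fin.castAdd ω i) ≠
      Fin.castAdd d (Fin.natAdd s j) := fun i j hij => by
    have := congrArg Fin.val hij
    simp at this
    omega
  have hne1 : ∀ (i : Fin (s + ω)) (j : Fin d), Fin.castAdd d i ≠ Fin.natAdd (s + ω) j :=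
    fun i j hij => by
      have := congrArg Fin.val hij
      simp at this
      omega
  simp only [hcast, hcast', timeVec, spaceVec, Pi.zero_apply, Pi.single_apply, hne, hne1,
    (hne _ _).symm, if_false, mul_zero, sub_zero, Finset.sum_const_zero, zero_sub,
    add_zero, ne_eq, OfNat.ofNat_ne_zero, not_false_eq_true, zero_pow, mul_one, mul_ite,
    Fin.castAdd_inj, Fin.natAdd_inj, Finset.sum_ite_eq', Finset.mem_univ, if_true,
    ite_pow, one_pow, zero_add, mul_neg, Finset.sum_neg_distrib, neg_sq, hε2]
  simp only [Finset.sum_add_distrib, Finset.sum_const, Finset.card_univ, Fintype.card_fin,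
    nsmul_eq_mul, ← Finset.mul_sum, mul_pow, hε2]
  ring_nf

end Wave

/-! ### The profile equation -/

/-- The profile `v` solves `A v'' + B v' = -μ |v|^{p-1} v` on `J`. -/
def IsProfile (μ p : ℝ) (A : ℝ → ℝ) (B : ℝ) (J : Set ℝ) (v : ℝ → ℝ) : Prop :=
  ∀ y ∈ J, A y * deriv (deriv v) y + B * deriv v y = -(μ * (|v y| ^ (p - 1) * v y))

theorem differentiableAt_of_contDiffOn {v : ℝ → ℝ} {I : Set ℝ} (hI : IsOpen I)
    (hv : ContDiffOn ℝ 2 v I) {y : ℝ} (hy : y ∈ I) : DifferentiableAt ℝ v y :=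
  (hv.contDiffAt (hI.mem_nhds hy)).differentiableAt (by norm_num)

theorem differentiableAt_deriv_of_contDiffOn {v : ℝ → ℝ} {I : Set ℝ} (hI : IsOpen I)
    (hv : ContDiffOn ℝ 2 v I) {y : ℝ} (hy : y ∈ I) : DifferentiableAt ℝ (deriv v) y :=
  ((hv.deriv_of_isOpen hI (m := 1) (by norm_num)).contDiffAt (hI.mem_nhds hy)).differentiableAt
    (by norm_num)

/-- Gronwall uniqueness along the path `b(1 - t)` from `b` towards the possibly singular point `0`.
The nonlinearity is read as a linear term with coefficient `μ|v|^(p-1)`, which is continuous along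
the given solution because `p > 1`. -/
theorem IsProfile.eq_zero_of_initial {μ p : ℝ} (hp : 1 < p) {A : ℝ → ℝ} {B : ℝ} {I J : Set ℝ}
    {v : ℝ → ℝ} (h : IsProfile μ p A B J v) (hI : IsOpen I) (hv : ContDiffOn ℝ 2 v I)
    (hJ : J.OrdConnected) (hJI : J ⊆ I) (h0 : (0 : ℝ) ∈ J) (hA : Continuous A)
    (hA0 : ∀ y ≠ 0, A y ≠ 0) {b : ℝ} (hb : b ≠ 0) (hbJ : b ∈ J) (hvb : v b = 0)
    (hvb' : deriv v b = 0) : v 0 = 0 := by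
  have hmem : ∀ t ∈ Icc (0 : ℝ) 1, b * (1 - t) ∈ J := fun t ht =>
    hJ.convex.segment_subset hbJ h0 ⟨1 - t, t, by linarith [ht.2], ht.1, by ring, by
      simp only [smul_eq_mul]; ring⟩
  have hline : ∀ t : ℝ, HasDerivAt (fun t : ℝ => b * (1 - t)) (-b) t := fun t => by
    simpa using ((hasDerivAt_id t).const_sub 1).const_mul b
  have hd : ∀ t ∈ Icc (0 : ℝ) 1, HasDerivAt (fun t => v (b * (1 - t)))
      (deriv v (b * (1 - t)) * -b) t := fun t ht =>
    (differentiableAt_of_contDiffOn hI hv (hJI (hmem t ht))).hasDerivAt.comp t (hline t)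
  have hdd : ∀ t ∈ Icc (0 : ℝ) 1, HasDerivAt (fun t => deriv v (b * (1 - t)))
      (deriv (deriv v) (b * (1 - t)) * -b) t := fun t ht =>
    HasDerivAt.comp (h₂ := deriv v) t
      (differentiableAt_deriv_of_contDiffOn hI hv (hJI (hmem t ht))).hasDerivAt (hline t)
  -- Stopping at `T < 1` keeps the path away from `0`, so the coefficient divided by `A` stays
  -- bounded; the value at `0` follows by continuity.
  have key : ∀ T ∈ Ico (0 : ℝ) 1, v (b * (1 - T)) = 0 := by
    intro T hT
    have hsub : Icc 0 T ⊆ Icc (0 : ℝ) 1 := Icc_subset_Icc_right hT.2.le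
    have hne : ∀ t ∈ Icc 0 T, A (b * (1 - t)) ≠ 0 := fun t ht =>
      hA0 _ (mul_ne_zero hb (by linarith [ht.2, hT.2]))
    have hcv : ContinuousOn (fun t => v (b * (1 - t))) (Icc 0 T) := fun t ht =>
      (hd t (hsub ht)).continuousAt.continuousWithinAt
    have hcg : ContinuousOn (fun t => (|B| + |μ| * |v (b * (1 - t))| ^ (p - 1)) /
        |A (b * (1 - t))|) (Icc 0 T) := by
      refine ContinuousOn.div ?_ ?_ fun t ht => abs_ne_zero.2 (hne t ht)
      · exact continuousOn_const.add (continuousOn_const.mul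
          (hcv.abs.rpow_const fun t _ => Or.inr (by linarith)))
      · exact (Continuous.abs (hA.comp (by fun_prop))).continuousOn
    obtain ⟨M, hM⟩ := isCompact_Icc.exists_bound_of_continuousOn hcg
    have hM0 : 0 ≤ M := (norm_nonneg _).trans (hM 0 ⟨le_rfl, hT.1⟩)
    -- In the maximum norm of `(v, v')` the equation gives `|v''| ≤ M‖(v, v')‖`; the factor `|b|` is
    -- the speed of the path, and `1 + M` covers both components.
    have := eq_zero_of_abs_deriv_le_mul_abs_self_of_eq_zero_right
      (f := fun t => (v (b * (1 - t)), deriv v (b * (1 - t))))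
      (f' := fun t => (deriv v (b * (1 - t)) * -b, deriv (deriv v) (b * (1 - t)) * -b))
      (K := |b| * (1 + M)) (a := 0) (b := T)
      (fun t ht => ((hd t (hsub ht)).prodMk (hdd t (hsub ht))).continuousAt.continuousWithinAt)
      (fun t ht => ((hd t (hsub (Ico_subset_Icc_self ht))).prodMk
        (hdd t (hsub (Ico_subset_Icc_self ht)))).hasDerivWithinAt)
      (by simp [hvb, hvb'])
      (fun t ht => by
        have ht' := Ico_subset_Icc_self ht
        have hode := h _ (hmem t (hsub ht'))
        have hMt := hM t ht'
        have hAt := abs_pos.2 (hne t ht')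
        set y := b * (1 - t)
        set F : ℝ := ‖(v y, deriv v y)‖ with hF
        have hF1 : |v y| ≤ F := le_max_left _ _
        have hF2 : |deriv v y| ≤ F := le_max_right _ _
        have hF0 : 0 ≤ F := norm_nonneg _
        rw [Real.norm_eq_abs, abs_of_nonneg (by positivity), div_le_iff₀ hAt] at hMt
        have hbound : |deriv (deriv v) y| ≤ M * F := by
          refine le_of_mul_le_mul_left ?_ hAt
          calc |A y| * |deriv (deriv v) y| = |A y * deriv (deriv v) y| := (abs_mul _ _).symm
            _ = |-(μ * (|v y| ^ (p - 1) * v y)) - B * deriv v y| := by rw [← hode]; ring_nf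
            _ ≤ |-(μ * (|v y| ^ (p - 1) * v y))| + |B * deriv v y| := abs_sub _ _
            _ = |μ| * |v y| ^ (p - 1) * |v y| + |B| * |deriv v y| := by
              rw [abs_neg, abs_mul, abs_mul, abs_mul, abs_of_nonneg (a := |v y| ^ (p - 1))
                (by positivity)]; ring
            _ ≤ |μ| * |v y| ^ (p - 1) * F + |B| * F := by gcongr
            _ = (|B| + |μ| * |v y| ^ (p - 1)) * F := by ring
            _ ≤ M * |A y| * F := by gcongr
            _ = |A y| * (M * F) := by ring
        refine max_le ?_ ?_
        · rw [Real.norm_eq_abs, abs_mul, abs_neg]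
          nlinarith [mul_nonneg hM0 hF0, mul_le_mul_of_nonneg_left hF2 (abs_nonneg b),
            mul_nonneg (abs_nonneg b) (mul_nonneg hM0 hF0)]
        · rw [Real.norm_eq_abs, abs_mul, abs_neg]
          nlinarith [mul_le_mul_of_nonneg_left hbound (abs_nonneg b),
            mul_nonneg (abs_nonneg b) hF0])
      T ⟨hT.1, le_rfl⟩
    exact congrArg Prod.fst this
  have hlim : Tendsto (fun t => v (b * (1 - t))) (𝓝[<] 1) (𝓝 (v 0)) := by
    have := (hd 1 ⟨zero_le_one, le_rfl⟩).continuousAt.tendsto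
    simp only [sub_self, mul_zero] at this
    exact this.mono_left nhdsWithin_le_nhds
  refine tendsto_nhds_unique hlim (tendsto_const_nhds.congr' ?_)
  filter_upwards [Ico_mem_nhdsLT (zero_lt_one' ℝ)] with t ht
  exact (key t ht).symm

/-- `v` takes each of its values on `J` on a totally disconnected set. -/
def NowhereConstant (v : ℝ → ℝ) (J : Set ℝ) : Prop :=
  ∀ c, IsTotallyDisconnected {y | y ∈ J ∧ v y = c}

/-! ### Totally disconnected level sets in one variable -/

theorem isTotallyDisconnected_of_not_Icc_subset {D : Set ℝ}
    (h : ∀ x y, x < y → ¬ Icc x y ⊆ D) : IsTotallyDisconnected D := by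
  intro t htD ht x hx y hy
  by_contra hxy
  rcases lt_or_gt_of_ne hxy with hlt | hlt
  · exact h x y hlt ((ht.ordConnected.out hx hy).trans htD)
  · exact h y x hlt ((ht.ordConnected.out hy hx).trans htD)

theorem not_Icc_subset {D : Set ℝ} (hD : IsTotallyDisconnected D) {x y : ℝ}
    (hxy : x < y) : ¬ Icc x y ⊆ D := fun h =>
  hxy.ne (hD _ h isPreconnected_Icc (left_mem_Icc.2 hxy.le) (right_mem_Icc.2 hxy.le))

/-- Where `v` is constant, `v' = v'' = 0` and the equation leaves `μ|v|^(p-1) v = 0`, so `v = 0`.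
Backward uniqueness then contradicts `v 0 ≠ 0`. -/
theorem IsProfile.nowhereConstant {μ p : ℝ} (hp : 1 < p) (hμ : μ ≠ 0) {A : ℝ → ℝ} {B : ℝ}
    {I J : Set ℝ} {v : ℝ → ℝ} (h : IsProfile μ p A B J v) (hI : IsOpen I)
    (hv : ContDiffOn ℝ 2 v I) (hJ : J.OrdConnected) (hJI : J ⊆ I) (h0 : (0 : ℝ) ∈ J)
    (hA : Continuous A) (hA0 : ∀ y ≠ 0, A y ≠ 0) (hv0 : v 0 ≠ 0) : NowhereConstant v J := by
  intro c
  refine isTotallyDisconnected_of_not_Icc_subset fun x y hxy hsub => ?_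
  -- Uniqueness starts only from points other than `0`; if the midpoint is `0`, the quarter point is
  -- not.
  obtain ⟨t, ht, ht0⟩ : ∃ t ∈ Ioo x y, t ≠ 0 := by
    by_cases h : (x + y) / 2 = 0
    · exact ⟨(3 * x + y) / 4, ⟨by linarith, by linarith⟩, fun h' => by linarith⟩
    · exact ⟨(x + y) / 2, ⟨by linarith, by linarith⟩, h⟩
  have hev : v =ᶠ[𝓝 t] fun _ => c := by
    filter_upwards [Ioo_mem_nhds ht.1 ht.2] with w hw using (hsub (Ioo_subset_Icc_self hw)).2
  have hd : deriv v =ᶠ[𝓝 t] fun _ => 0 := by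
    filter_upwards [hev.eventually_nhds] with w hw
    rw [EventuallyEq.deriv_eq hw, deriv_const]
  have htJ : t ∈ J := (hsub (Ioo_subset_Icc_self ht)).1
  have hode := h t htJ
  rw [hd.deriv_eq, deriv_const, hd.eq_of_nhds, mul_zero, mul_zero, add_zero, eq_comm, neg_eq_zero,
    mul_eq_zero, or_iff_right hμ, mul_eq_zero] at hode
  have hvt : v t = 0 := by
    rcases hode with h | h
    · exact abs_eq_zero.1 ((Real.rpow_eq_zero (abs_nonneg _) (by linarith)).1 h)
    · exact h
  exact hv0 (h.eq_zero_of_initial hp hI hv hJ hJI h0 hA hA0 ht0 htJ hvt hd.eq_of_nhds)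

theorem NowhereConstant.isTotallyDisconnected_deriv {v : ℝ → ℝ} {J : Set ℝ}
    (h : NowhereConstant v J) (hd : ∀ y ∈ J, DifferentiableAt ℝ v y) :
    IsTotallyDisconnected {y | y ∈ J ∧ deriv v y = 0} := by
  refine isTotallyDisconnected_of_not_Icc_subset fun x y hxy hsub => ?_
  refine not_Icc_subset (h (v x)) hxy fun t ht => ⟨(hsub ht).1, ?_⟩
  refine constant_of_derivWithin_zero (a := x) (b := y)
    (fun w hw => (hd w (hsub hw).1).differentiableWithinAt) (fun w hw => ?_) t ht
  have hw' := hsub (Ico_subset_Icc_self hw)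
  rw [(hd w hw'.1).derivWithin (uniqueDiffOn_Icc hxy w (Ico_subset_Icc_self hw)), hw'.2]

/-- On the critical set, `φ` takes the zeros of `v'` as values and possibly one more, its value at
its own critical points. -/
theorem isTotallyDisconnected_insert {D : Set ℝ} (hD : IsTotallyDisconnected D) (a : ℝ) :
    IsTotallyDisconnected (insert a D) := by
  refine isTotallyDisconnected_of_not_Icc_subset fun x y hxy hsub => ?_
  rcases le_or_gt y a with h | h
  · refine not_Icc_subset hD (x := x) (y := (x + y) / 2) (by linarith) fun t ht => ?_
    refine (hsub ⟨ht.1, by linarith [ht.2]⟩).resolve_left ?_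
    intro h'; linarith [ht.2]
  · have hm : max x a < y := max_lt hxy h
    have h1 := le_max_left x a
    have h2 := le_max_right x a
    refine not_Icc_subset hD (x := (max x a + y) / 2) (y := y) (by linarith) fun t ht => ?_
    refine (hsub ⟨by linarith [ht.1], ht.2⟩).resolve_left ?_
    intro h'; linarith [ht.1]

/-- The image of an interval under `κt²` is connected, so it would have to be a single point; but
`κt²` cannot agree at both end points and the midpoint. -/
theorem NowhereConstant.comp_sq {v : ℝ → ℝ} {J : Set ℝ} (h : NowhereConstant v J) {κ : ℝ}
    (hκ : κ ≠ 0) : NowhereConstant (fun t => v (κ * t ^ 2)) ((fun t => κ * t ^ 2) ⁻¹' J) := by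
  intro c
  refine isTotallyDisconnected_of_not_Icc_subset fun x y hxy hsub => ?_
  have hpre : IsPreconnected ((fun t : ℝ => κ * t ^ 2) '' Icc x y) :=
    isPreconnected_Icc.image _ (by fun_prop)
  have hsubs := h c _ (by rintro _ ⟨t, ht, rfl⟩; exact hsub ht) hpre
  have e1 := hsubs (mem_image_of_mem _ (left_mem_Icc.2 hxy.le))
    (mem_image_of_mem _ (right_mem_Icc.2 hxy.le))
  have e2 := hsubs (mem_image_of_mem _ (left_mem_Icc.2 hxy.le))
    (mem_image_of_mem _ (show (x + y) / 2 ∈ Icc x y from ⟨by linarith, by linarith⟩))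
  have e1' := mul_left_cancel₀ hκ e1
  have e2' := mul_left_cancel₀ hκ e2
  have hxy' : 0 < (y - x) ^ 2 := by have := sub_pos.2 hxy; positivity
  nlinarith

open MeasureTheory in
-- One-dimensional Sard: the critical values form a null set, whereas the nonconstant continuous `v`
-- attains a whole nondegenerate interval of values on `[a, b]`. The additional value `c₀` to be
-- avoided will be `v 0`, where the critical points of `ell k n` lie.
theorem NowhereConstant.exists_regular_value {v : ℝ → ℝ} {J : Set ℝ} (h : NowhereConstant v J)
    (hd : ∀ y ∈ J, DifferentiableAt ℝ v y) (c₀ : ℝ) {a b : ℝ} (hab : a < b) (hJ : Icc a b ⊆ J) :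
    ∃ y ∈ Icc a b, v y ≠ c₀ ∧ ∀ x ∈ J, v x = v y → deriv v x ≠ 0 := by
  by_contra hcon
  push Not at hcon
  set K := {x | x ∈ J ∧ deriv v x = 0} with hK
  have hnull : volume (v '' K) = 0 := by
    refine addHaar_image_eq_zero_of_det_fderivWithin_eq_zero volume
      (f' := fun x => ContinuousLinearMap.toSpanSingleton ℝ (deriv v x))
      (fun x hx => (hd x hx.1).hasDerivAt.hasFDerivAt.hasFDerivWithinAt) fun x hx => ?_
    rw [hx.2]
    simp
  have hnull' : volume (insert c₀ (v '' K)) = 0 := by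
    rw [insert_eq, measure_union_null_iff]
    exact ⟨by simp, hnull⟩
  obtain ⟨t, ht, hta⟩ : ∃ t ∈ Icc a b, v t ≠ v a := by
    by_contra hno
    push Not at hno
    exact not_Icc_subset (h (v a)) hab fun t ht => ⟨hJ ht, hno t ht⟩
  have hsub : uIcc (v a) (v t) ⊆ insert c₀ (v '' K) := by
    have hat : uIcc a t ⊆ Icc a b := by
      rw [uIcc_of_le ht.1]; exact Icc_subset_Icc_right ht.2
    refine (intermediate_value_uIcc (f := v) fun w hw =>
      (hd w (hJ (hat hw))).continuousAt.continuousWithinAt).trans ?_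
    rintro _ ⟨w, hw, rfl⟩
    by_cases hw0 : v w = c₀
    · exact Or.inl hw0
    · obtain ⟨x, hx, hxw, hx0⟩ := hcon w (hat hw) hw0
      exact Or.inr ⟨x, ⟨hx, hx0⟩, hxw⟩
  have h0 := measure_mono_null hsub hnull'
  rw [uIcc, Real.volume_Icc, ENNReal.ofReal_eq_zero] at h0
  have : v a ⊓ v t < v a ⊔ v t := inf_lt_sup.2 hta.symm
  linarith

/-! ### Components of level sets and critical sets -/

/-- The image of a component under `φ` is a preconnected subset of `D`, hence one point. -/
theorem connectedComponentIn_eq_inter_fiber {X : Type*} [TopologicalSpace X] {φ : X → ℝ}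
    (hφ : Continuous φ) {F : Set X} {D : Set ℝ} (hD : IsTotallyDisconnected D)
    (h : ∀ z ∈ F, φ z ∈ D) {z : X} (hz : z ∈ F) :
    connectedComponentIn F z = connectedComponentIn (F ∩ φ ⁻¹' {φ z}) z := by
  refine Subset.antisymm ?_ (connectedComponentIn_mono _ inter_subset_left)
  refine isPreconnected_connectedComponentIn.subset_connectedComponentIn
    (mem_connectedComponentIn hz) fun w hw => ⟨connectedComponentIn_subset _ _ hw, ?_⟩
  refine hD (φ '' connectedComponentIn F z) ?_ (isPreconnected_connectedComponentIn.image _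
    hφ.continuousOn) (mem_image_of_mem _ hw) (mem_image_of_mem _ (mem_connectedComponentIn hz))
  rintro _ ⟨w, hw, rfl⟩
  exact h w (connectedComponentIn_subset _ _ hw)

/-- On `φ ⁻¹' I` the function `u` factors as `w ∘ φ` with a differentiable profile `w` that is
constant on no interval of values of `φ`. -/
structure Factors (u φ : SemiEuclid s r → ℝ) (w : ℝ → ℝ) (I : Set ℝ) : Prop where
  differentiable : Differentiable ℝ φ
  isOpen : IsOpen I
  eq : ∀ z ∈ φ ⁻¹' I, u z = w (φ z)
  differentiableAt : ∀ y ∈ I, DifferentiableAt ℝ w y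
  nowhereConstant : NowhereConstant w (I ∩ range φ)

namespace Factors

variable {u φ : SemiEuclid s r → ℝ} {w : ℝ → ℝ} {I : Set ℝ}

theorem hasFDerivAt (h : Factors u φ w I) {z : SemiEuclid s r} (hz : φ z ∈ I) :
    HasFDerivAt u (deriv w (φ z) • fderiv ℝ φ z) z := by
  refine ((h.differentiableAt _ hz).hasDerivAt.comp_hasFDerivAt z
    (h.differentiable z).hasFDerivAt).congr_of_eventuallyEq ?_
  filter_upwards [(h.isOpen.preimage h.differentiable.continuous).mem_nhds hz] with y hy
  exact h.eq y hy

theorem criticalSet_eq (h : Factors u φ w I) : criticalSet u (φ ⁻¹' I) =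
    {z | φ z ∈ I ∧ (deriv w (φ z) = 0 ∨ fderiv ℝ φ z = 0)} := by
  ext z
  refine and_congr_right fun hz => ?_
  rw [(h.hasFDerivAt hz).fderiv, smul_eq_zero]

theorem levelSet_eq (h : Factors u φ w I) (c : ℝ) : levelSet u (φ ⁻¹' I) c =
    φ ⁻¹' {y | y ∈ I ∩ range φ ∧ w y = c} := by
  ext z
  constructor
  · rintro ⟨hz, hc⟩
    exact ⟨⟨hz, z, rfl⟩, (h.eq z hz).symm.trans hc⟩
  · rintro ⟨⟨hz, -⟩, hc⟩
    exact ⟨hz, (h.eq z hz).trans hc⟩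

theorem connectedComponentIn_levelSet (h : Factors u φ w I) {z : SemiEuclid s r} (hz : φ z ∈ I) :
    connectedComponentIn (levelSet u (φ ⁻¹' I) (u z)) z =
      connectedComponentIn (φ ⁻¹' {φ z}) z := by
  have hz' : z ∈ levelSet u (φ ⁻¹' I) (u z) := ⟨hz, rfl⟩
  rw [h.levelSet_eq] at hz' ⊢
  rw [connectedComponentIn_eq_inter_fiber (F := φ ⁻¹' {y | y ∈ I ∩ range φ ∧ w y = u z})
    h.differentiable.continuous (h.nowhereConstant (u z))
    (fun _ hw => hw) hz', inter_eq_right.2]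
  intro y hy
  rw [mem_preimage, mem_singleton_iff] at hy
  rw [mem_preimage, hy]
  exact hz'

theorem exists_of_isComponent_levelSet (h : Factors u φ w I) {S : Set (SemiEuclid s r)} {c : ℝ}
    (hS : IsComponent S (levelSet u (φ ⁻¹' I) c)) :
    ∃ z, φ z ∈ I ∧ u z = c ∧ S = connectedComponentIn (φ ⁻¹' {φ z}) z := by
  obtain ⟨z, ⟨hz, rfl⟩, rfl⟩ := hS
  exact ⟨z, hz, rfl, h.connectedComponentIn_levelSet hz⟩

theorem isTotallyDisconnected_deriv (h : Factors u φ w I) :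
    IsTotallyDisconnected {y | y ∈ I ∩ range φ ∧ deriv w y = 0} :=
  h.nowhereConstant.isTotallyDisconnected_deriv fun y hy => h.differentiableAt y hy.1

theorem connectedComponentIn_criticalSet (h : Factors u φ w I) {a : ℝ}
    (hφ : ∀ z, fderiv ℝ φ z = 0 → φ z = a) {z : SemiEuclid s r}
    (hz : z ∈ criticalSet u (φ ⁻¹' I)) :
    connectedComponentIn (criticalSet u (φ ⁻¹' I)) z =
      connectedComponentIn (criticalSet u (φ ⁻¹' I) ∩ φ ⁻¹' {φ z}) z := by
  refine connectedComponentIn_eq_inter_fiber h.differentiable.continuous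
    (isTotallyDisconnected_insert h.isTotallyDisconnected_deriv a) (fun y hy => ?_) hz
  rw [h.criticalSet_eq] at hy
  obtain ⟨hy, hy' | hy'⟩ := hy
  · exact Or.inr ⟨⟨hy, y, rfl⟩, hy'⟩
  · exact Or.inl (hφ y hy')

theorem connectedComponentIn_criticalSet_of_deriv (h : Factors u φ w I) {a : ℝ}
    (hφ : ∀ z, fderiv ℝ φ z = 0 → φ z = a) {z : SemiEuclid s r} (hz : φ z ∈ I)
    (hz' : deriv w (φ z) = 0) :
    connectedComponentIn (criticalSet u (φ ⁻¹' I)) z = connectedComponentIn (φ ⁻¹' {φ z}) z := by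
  rw [h.connectedComponentIn_criticalSet hφ (by rw [h.criticalSet_eq]; exact ⟨hz, Or.inl hz'⟩),
    inter_eq_right.2]
  intro y hy
  rw [mem_preimage, mem_singleton_iff] at hy
  rw [h.criticalSet_eq, mem_ofPred_eq, hy]
  exact ⟨hz, Or.inl hz'⟩

/-- The gradient of `u` is `v'(φ)∇φ`; on a fiber where `v' ≠ 0` it vanishes exactly with `∇φ`, and
all critical points of `φ` lie on that fiber. -/
theorem connectedComponentIn_criticalSet_of_deriv_ne (h : Factors u φ w I) {a : ℝ}
    (hφ : ∀ z, fderiv ℝ φ z = 0 → φ z = a) {z : SemiEuclid s r}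
    (hz : z ∈ criticalSet u (φ ⁻¹' I)) (hz' : deriv w (φ z) ≠ 0) :
    connectedComponentIn (criticalSet u (φ ⁻¹' I)) z =
      connectedComponentIn {y | fderiv ℝ φ y = 0} z := by
  rw [h.connectedComponentIn_criticalSet hφ hz]
  rw [h.criticalSet_eq] at hz ⊢
  congr 1
  ext y
  have hφz := hφ z (hz.2.resolve_left hz')
  constructor
  · rintro ⟨⟨hy, hy'⟩, hyz⟩
    rw [mem_preimage, mem_singleton_iff] at hyz
    rw [hyz] at hy'
    exact hy'.resolve_left hz'
  · intro hy
    have hyz : φ y = φ z := (hφ y hy).trans hφz.symm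
    refine ⟨⟨?_, Or.inr hy⟩, hyz⟩
    rw [hyz]; exact hz.1

end Factors

/-! ### Functions whose fibers are translates of each other -/

/-- `φ` increases with unit speed along the lines in direction `e`. -/
def IsTransverse (φ : SemiEuclid s r → ℝ) (e : SemiEuclid s r) : Prop :=
  ∀ z (l : ℝ), φ (z + l • e) = φ z + l

theorem isTransverse_form {a : SemiEuclid s r} (ha : form a a ≠ 0) :
    IsTransverse (form a) ((form a a)⁻¹ • a) := fun z l => by
  rw [form_add_right, form_smul_right, form_smul_right, inv_mul_cancel₀ ha, mul_one]

theorem exists_isTransverse_parabolicFun {ω : ℕ} (h : s + ω ≤ r) (ε : Fin s → ℝ) (hω : 1 ≤ ω) :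
    ∃ e, IsTransverse (parabolicFun h ε) e := by
  let j₀ : Fin ω := ⟨0, hω⟩
  have hi : ∀ i : Fin s, Fin.castLE (le_trans (Nat.le_add_right s ω) h) i ≠
      Fin.castLE h (Fin.natAdd s j₀) := fun i hij => by
    have := congrArg Fin.val hij
    simp at this
    omega
  have hj : ∀ j : Fin ω, (Fin.castLE h (Fin.natAdd s j) = Fin.castLE h (Fin.natAdd s j₀)) ↔
      j = j₀ := fun j => by
    simp [Fin.ext_iff]
  -- The coordinate `x_{s+1}` enters the generator as `2x_{s+1}`, whence the factor `1/2`.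
  refine ⟨(0, Pi.single (Fin.castLE h (Fin.natAdd s j₀)) (1 / 2)), fun z l => ?_⟩
  rw [parabolicFun_add_smul]
  simp [Pi.single_apply, hi, hj]

namespace IsTransverse

variable {φ : SemiEuclid s r → ℝ} {e : SemiEuclid s r}

theorem fderiv_ne_zero (h : IsTransverse φ e) (hφ : Differentiable ℝ φ) (z : SemiEuclid s r) :
    fderiv ℝ φ z ≠ 0 := fun h0 => by
  have := fderiv_apply_of_line (b := 1) (c := 0) (e := e) (hφ z) fun l => by rw [h z l]; ring
  rw [h0] at this
  simp at this

/-- Sliding every point along `e` until `φ = y` is a continuous retraction of the whole space onto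
the fiber. -/
theorem isPreconnected_fiber (h : IsTransverse φ e) (hφ : Continuous φ) (y : ℝ) :
    IsPreconnected (φ ⁻¹' {y}) := by
  have : φ ⁻¹' {y} = (fun z => z + (y - φ z) • e) '' univ := by
    ext z
    constructor
    · intro hz
      rw [mem_preimage, mem_singleton_iff] at hz
      exact ⟨z, mem_univ z, by simp [hz]⟩
    · rintro ⟨z, -, rfl⟩
      simp [h z]
  rw [this]
  exact isPreconnected_univ.image _ (by fun_prop)

theorem homothetic_fiber (h : IsTransverse φ e) (y y' : ℝ) :
    Homothetic (φ ⁻¹' {y}) (φ ⁻¹' {y'}) := by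
  have : φ ⁻¹' {y} = (fun z => z + (y - y') • e) '' (φ ⁻¹' {y'}) := by
    ext z
    simp only [mem_preimage, mem_singleton_iff, mem_image]
    constructor
    · intro hz
      refine ⟨z + (y' - y) • e, by rw [h, hz]; ring, ?_⟩
      module
    · rintro ⟨z, hz, rfl⟩
      rw [h, hz]; ring
  rw [this]
  exact homothetic_add _ _

theorem homothetic_connectedComponentIn (h : IsTransverse φ e) (hφ : Continuous φ)
    (z : SemiEuclid s r) (y : ℝ) :
    Homothetic (connectedComponentIn (φ ⁻¹' {φ z}) z) (φ ⁻¹' {y}) := by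
  rw [(h.isPreconnected_fiber hφ (φ z)).connectedComponentIn rfl]
  exact h.homothetic_fiber _ _

theorem homothetic_of_isRegularComponent (h : IsTransverse φ e) {u : SemiEuclid s r → ℝ}
    {w : ℝ → ℝ} {I : Set ℝ} (hu : Factors u φ w I) {S : Set (SemiEuclid s r)}
    (hS : IsRegularComponent u (φ ⁻¹' I) S) (y : ℝ) : Homothetic S (φ ⁻¹' {y}) := by
  obtain ⟨c, -, hS⟩ := hS
  obtain ⟨z, -, -, rfl⟩ := hu.exists_of_isComponent_levelSet hS
  exact h.homothetic_connectedComponentIn hu.differentiable.continuous z y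

theorem homothetic_of_isComponent_criticalSet (h : IsTransverse φ e) {u : SemiEuclid s r → ℝ}
    {w : ℝ → ℝ} {I : Set ℝ} (hu : Factors u φ w I) {V : Set (SemiEuclid s r)}
    (hV : IsComponent V (criticalSet u (φ ⁻¹' I))) (y : ℝ) : Homothetic V (φ ⁻¹' {y}) := by
  obtain ⟨z, hz, rfl⟩ := hV
  rw [hu.criticalSet_eq] at hz
  rw [hu.connectedComponentIn_criticalSet_of_deriv (a := 0)
    (fun z hz => absurd hz (h.fderiv_ne_zero hu.differentiable z)) hz.1
    (hz.2.resolve_right (h.fderiv_ne_zero hu.differentiable z))]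
  exact h.homothetic_connectedComponentIn hu.differentiable.continuous z y

theorem homothetic_of_isComponent_preimage (h : IsTransverse φ e) (hφ : Continuous φ) {D : Set ℝ}
    (hD : IsTotallyDisconnected D) {B : Set (SemiEuclid s r)} (hB : IsComponent B (φ ⁻¹' D))
    (y : ℝ) : Homothetic B (φ ⁻¹' {y}) := by
  obtain ⟨z, hz, rfl⟩ := hB
  rw [connectedComponentIn_eq_inter_fiber (F := φ ⁻¹' D) hφ hD (fun _ h => h) hz, inter_eq_right.2]
  · exact h.homothetic_connectedComponentIn hφ z y
  · intro w hw
    rw [mem_preimage, mem_singleton_iff] at hw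
    rw [mem_preimage, hw]; exact hz

end IsTransverse

/-! ### The blow-up set -/

/-- Continuity excludes blow-up inside the domain, and a point of its closure has `φ`-value in
`closure I`. Conversely `hTI` ensures that the end fibers really lie in the closure of the domain.
-/
theorem blowUpSet_eq {φ u : SemiEuclid s r → ℝ} {I T : Set ℝ} (hφ : Continuous φ)
    (hI : IsOpen I) (hu : ∀ z ∈ φ ⁻¹' I, ContinuousAt u z) (hT : ∀ R ∈ T, BlowsUpAs φ I u R)
    (hcl : closure I ⊆ I ∪ T) (hTI : ∀ R ∈ T, ∀ z, φ z = R → z ∈ closure (φ ⁻¹' I)) :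
    blowUpSet u (φ ⁻¹' I) = φ ⁻¹' T := by
  ext z
  constructor
  · rintro ⟨hz, hlim⟩
    refine (hcl (map_mem_closure hφ hz fun w hw => hw)).resolve_left fun hzI => ?_
    rw [(hI.preimage hφ).nhdsWithin_eq hzI] at hlim
    exact not_tendsto_nhds_of_tendsto_atTop hlim _ (hu z hzI).abs
  · intro hz
    refine ⟨hTI _ hz z rfl, (hT _ hz).mono_left ?_⟩
    exact inf_le_inf_right _ (hφ.tendsto z).le_comap

/-- The point is approached radially by `c • z` with `c → 1` from below. -/
theorem mem_closure_of_ell {k n : ℕ} {I : Set ℝ} {z : SemiEuclid s r}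
    (h : ∀ c ∈ Ioo (0 : ℝ) 1, c ^ 2 * ell k n z ∈ I) : z ∈ closure (ell k n ⁻¹' I) := by
  have hlim : Tendsto (fun c : ℝ => c • z) (𝓝[<] 1) (𝓝 z) := by
    have : Tendsto (fun c : ℝ => c • z) (𝓝 1) (𝓝 ((1 : ℝ) • z)) :=
      (continuous_id.smul continuous_const).tendsto 1
    rw [one_smul] at this
    exact this.mono_left nhdsWithin_le_nhds
  refine mem_closure_of_tendsto hlim ?_
  filter_upwards [Ioo_mem_nhdsLT (zero_lt_one' ℝ)] with c hc
  rw [mem_preimage, ell_smul]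
  exact h c hc

theorem IsTransverse.mem_closure {φ : SemiEuclid s r → ℝ} {e : SemiEuclid s r}
    (h : IsTransverse φ e) {I : Set ℝ} {z : SemiEuclid s r} (hz : φ z ∈ closure I) :
    z ∈ closure (φ ⁻¹' I) := by
  have := map_mem_closure (f := fun y : ℝ => z + (y - φ z) • e) (t := φ ⁻¹' I) (by fun_prop) hz
    fun y hy => by
      rw [mem_preimage, h]; simpa using hy
  simpa using this

/-! ### Solutions factor through a nowhere constant profile -/

/-- The equation is known only at values taken by `φ`; since `range φ` is connected and contains
`0`, these form an interval through `0`, as uniqueness requires. -/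
theorem factors_of_profile {φ u : SemiEuclid s r → ℝ} {v : ℝ → ℝ} {I : Set ℝ} {μ p : ℝ}
    (hp : 1 < p) (hμ : μ ≠ 0) (hφ : ContDiff ℝ 2 φ) (h0 : φ 0 = 0) (hI : IsOpen I)
    (hIc : I.OrdConnected) (hI0 : (0 : ℝ) ∈ I) (hv0 : 0 < v 0) (hv : ContDiffOn ℝ 2 v I)
    (hu : ∀ z ∈ φ ⁻¹' I, u z = v (φ z))
    (hsol : ∀ z ∈ φ ⁻¹' I, -(dAlembertian u z) = μ * (|u z| ^ (p - 1) * u z))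
    {A : ℝ → ℝ} {B : ℝ} (hA : Continuous A) (hA0 : ∀ y ≠ 0, A y ≠ 0)
    (hbox : ∀ z ∈ φ ⁻¹' I, dAlembertian u z =
      A (φ z) * deriv (deriv v) (φ z) + B * deriv v (φ z)) : Factors u φ v I := by
  have hprof : IsProfile μ p A B (I ∩ range φ) v := by
    rintro _ ⟨hy, z, rfl⟩
    rw [← hbox z hy, ← hu z hy, ← hsol z hy, neg_neg]
  refine ⟨hφ.differentiable (by norm_num), hI, hu,
    fun y hy => differentiableAt_of_contDiffOn hI hv hy, ?_⟩
  exact hprof.nowhereConstant hp hμ hI hv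
    (hIc.inter (isPreconnected_range hφ.continuous).ordConnected) inter_subset_left
    ⟨hI0, 0, h0⟩ hA hA0 hv0.ne'

section Solutions

variable {k n : ℕ} {μ p : ℝ} {φ u : SemiEuclid s r → ℝ} {I : Set ℝ}

theorem IsSolutionThrough.factors_ell (hk : k ≤ s) (hn : n ≤ r) (hp : 1 < p)
    (hμ : μ ≠ 0) (hI : IsOpen I) (hIc : I.OrdConnected) (hI0 : (0 : ℝ) ∈ I)
    (h : IsSolutionThrough μ p (ell k n) I u) :
    ∃ v, Factors u (ell k n) v I ∧ 0 < v 0 ∧ deriv v 0 ≠ 0 := by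
  obtain ⟨⟨v, hv0, hv, hu⟩, hsol⟩ := h
  have hbox : ∀ z ∈ ell k n ⁻¹' I, dAlembertian u z = (4 * ell k n z) *
      deriv (deriv v) (ell k n z) + (2 * (k + n) : ℝ) * deriv v (ell k n z) :=
    fun z hz => dAlembertian_comp_ell hk hn hI hv hu hz
  refine ⟨v, factors_of_profile hp hμ (contDiff_ell k n) (ell_zero k n) hI hIc hI0 hv0 hv hu hsol
    (A := fun y => 4 * y) (by fun_prop) (fun y hy => mul_ne_zero (by norm_num) hy) hbox, hv0, ?_⟩
  -- At the origin the coefficient of `v''` vanishes, so `v'(0) = 0` would leave `μ v(0)^p = 0`.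
  intro hd
  have hz : (0 : SemiEuclid s r) ∈ ell k n ⁻¹' I := by
    rw [mem_preimage, ell_zero]; exact hI0
  have h1 := hsol 0 hz
  rw [hbox 0 hz, hu 0 hz, ell_zero, hd] at h1
  have : 0 < |v 0| ^ (p - 1) * v 0 := by positivity
  have h2 : μ * (|v 0| ^ (p - 1) * v 0) = 0 := by rw [← h1]; ring
  exact mul_ne_zero hμ this.ne' h2

theorem IsSolutionThrough.factors_parabolicFun {ω : ℕ} (h : s + ω ≤ r) {ε : Fin s → ℝ}
    (hω : 1 ≤ ω) (hε : ∀ i, ε i = 1 ∨ ε i = -1) (hp : 1 < p) (hμ : μ ≠ 0) (hI : IsOpen I)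
    (hIc : I.OrdConnected) (hI0 : (0 : ℝ) ∈ I)
    (hsol : IsSolutionThrough μ p (parabolicFun h ε) I u) :
    ∃ v, Factors u (parabolicFun h ε) v I := by
  obtain ⟨⟨v, hv0, hv, hu⟩, hsol⟩ := hsol
  have hω' : (ω : ℝ) ≠ 0 := by exact_mod_cast (by omega : ω ≠ 0)
  refine ⟨v, factors_of_profile hp hμ (contDiff_parabolicFun h ε) (by simp [parabolicFun]) hI hIc
    hI0 hv0 hv hu hsol (A := fun _ => 4 * (ω : ℝ)) (B := 0) continuous_const
    (fun _ _ => mul_ne_zero (by norm_num) hω') fun z hz => ?_⟩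
  rw [dAlembertian_comp_parabolicFun h hε hI hv hu hz, zero_mul, add_zero]

theorem IsSolutionThrough.factors_form {a : SemiEuclid s r} (hp : 1 < p) (hμ : μ ≠ 0)
    (hI : IsOpen I) (hIc : I.OrdConnected) (hI0 : (0 : ℝ) ∈ I)
    (hsol : IsSolutionThrough μ p (form a) I u) :
    form a a ≠ 0 ∧ ∃ v, Factors u (form a) v I := by
  obtain ⟨⟨v, hv0, hv, hu⟩, hsol⟩ := hsol
  have hbox := fun z hz => dAlembertian_comp_form (z := z) a hI hv hu hz
  -- For null `a` every `v ∘ ⟨a, ·⟩` satisfies `□u = 0`, which is incompatible with `v 0 > 0`.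
  have ha : form a a ≠ 0 := by
    intro ha
    have hz : (0 : SemiEuclid s r) ∈ form a ⁻¹' I := by
      rw [mem_preimage, form_zero_right]; exact hI0
    have h1 := hsol 0 hz
    rw [hbox 0 hz, hu 0 hz, form_zero_right, ha, zero_mul, neg_zero] at h1
    have : 0 < |v 0| ^ (p - 1) * v 0 := by positivity
    exact mul_ne_zero hμ this.ne' h1.symm
  refine ⟨ha, v, factors_of_profile hp hμ (contDiff_form a) (form_zero_right a) hI hIc
    hI0 hv0 hv hu hsol (A := fun _ => form a a) (B := 0) continuous_const
    (fun _ _ => ha) fun z hz => ?_⟩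
  rw [hbox z hz, zero_mul, add_zero]

/-- For `k + n = 1` the generator is `±ψ²` with `ψ` linear. Passing to `ψ` splits its fibers into
parallel hyperplanes and turns the critical hyperplane `ψ = 0` into an ordinary fiber. -/
theorem Factors.comp_sq {ψ : SemiEuclid s r → ℝ} {v : ℝ → ℝ} {κ : ℝ} (hκ : κ ≠ 0)
    (hψ : Differentiable ℝ ψ) (hφ : ∀ z, φ z = κ * ψ z ^ 2) (h : Factors u φ v I) :
    Factors u ψ (fun t => v (κ * t ^ 2)) ((fun t => κ * t ^ 2) ⁻¹' I) := by
  refine ⟨hψ, h.isOpen.preimage (by fun_prop), fun z hz => ?_, fun t ht => ?_, ?_⟩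
  · rw [mem_preimage, mem_preimage, ← hφ] at hz
    rw [h.eq z hz, hφ]
  · exact (h.differentiableAt _ ht).comp t (by fun_prop)
  · intro c t ht htc
    refine h.nowhereConstant.comp_sq hκ c t (fun y hy => ?_) htc
    obtain ⟨⟨hyI, z, rfl⟩, hyc⟩ := ht hy
    exact ⟨⟨hyI, z, hφ z⟩, hyc⟩

/-! ### The definite cases -/

/-- The description of the level sets and of the critical set of a solution through `φ`, together
with that of the fibers of `φ` over nonzero values, by one model. -/
structure HasModel (k n : ℕ) (φ u : SemiEuclid s r → ℝ) (I : Set ℝ) (σ : Shape)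
    (M : Set (SemiEuclid s r)) : Prop where
  isModel : IsModel k n σ M
  continuousAt : ∀ z ∈ φ ⁻¹' I, ContinuousAt u z
  parabolic : σ = Shape.parabolic → k + n = 0
  regular : ∀ S, IsRegularComponent u (φ ⁻¹' I) S → Homothetic S M
  linear : ∀ a, φ = form a → Homothetic M (hyperplane a)
  critical : CriticalModelOrFocal k n u (φ ⁻¹' I) M
  fiber : ∀ z, φ z ≠ 0 → Homothetic (connectedComponentIn (φ ⁻¹' {φ z}) z) M

theorem Factors.continuousAt {v : ℝ → ℝ} (h : Factors u φ v I) :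
    ∀ z ∈ φ ⁻¹' I, ContinuousAt u z := fun _ hz => (h.hasFDerivAt hz).continuousAt

/-- The transverse function `ψ` is `φ` itself or a linear form with `φ = ±ψ²`; in the latter case a
fiber of `φ` can consist of several fibers of `ψ`, which `hfib` allows for. -/
theorem IsTransverse.hasModel {ψ : SemiEuclid s r → ℝ} {e : SemiEuclid s r} {w : ℝ → ℝ}
    {I' : Set ℝ} {σ : Shape} {M : Set (SemiEuclid s r)} (h : IsTransverse ψ e)
    (hu : Factors u ψ w I') (hI : φ ⁻¹' I = ψ ⁻¹' I') (hψM : Homothetic (ψ ⁻¹' {0}) M)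
    (hM : IsModel k n σ M) (hpar : σ = Shape.parabolic → k + n = 0)
    (hlin : ∀ a, φ = form a → Homothetic M (hyperplane a))
    (hfib : ∀ z, ∃ D, IsTotallyDisconnected D ∧ φ ⁻¹' {φ z} = ψ ⁻¹' D) :
    HasModel k n φ u I σ M := by
  refine ⟨hM, ?_, hpar, fun S hS => ?_, hlin, fun V hV => Or.inl ?_, fun z _ => ?_⟩
  · rw [hI]; exact hu.continuousAt
  · rw [hI] at hS
    exact (h.homothetic_of_isRegularComponent hu hS 0).trans hψM
  · rw [hI] at hV
    exact (h.homothetic_of_isComponent_criticalSet hu hV 0).trans hψM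
  · obtain ⟨D, hD, hφD⟩ := hfib z
    have hz : z ∈ φ ⁻¹' {φ z} := rfl
    rw [hφD] at hz ⊢
    exact (h.homothetic_of_isComponent_preimage hu.differentiable.continuous hD
      ⟨z, hz, rfl⟩ 0).trans hψM

/-- A function both even and odd vanishes, but `ell k n` is `±1` on a coordinate vector. -/
theorem ell_ne_form (hs : 0 < s) (hr : 0 < r) (hkn : 0 < k + n) (a : SemiEuclid s r) :
    ell k n ≠ form a := by
  intro h
  have key : ∀ z : SemiEuclid s r, ell k n z = 0 := fun z => by
    have h1 : ell k n (-z) = ell k n z := by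
      rw [← neg_one_smul ℝ, ell_smul]; ring
    rw [h, ← neg_one_smul ℝ, form_smul_right] at h1
    rw [h]; linarith
  rcases Nat.eq_zero_or_pos n with hn | hn
  · have := key (timeVec ⟨0, hs⟩)
    rw [ell_timeVec hs (by omega)] at this
    norm_num at this
  · have := key (spaceVec ⟨0, hr⟩)
    rw [ell_spaceVec hr hn] at this
    norm_num at this

theorem isTotallyDisconnected_sq_eq {κ : ℝ} (hκ : κ ≠ 0) (y : ℝ) :
    IsTotallyDisconnected {t : ℝ | κ * t ^ 2 = y} := by
  have : NowhereConstant (fun y => y) univ := fun c t ht _ x hx y hy =>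
    (ht hx).2.trans (ht hy).2.symm
  have h := this.comp_sq hκ y
  simpa using h

theorem IsModel.ell_zero_left_fiber (hn2 : 2 ≤ n) (hn : n ≤ r) {y : ℝ} (hy : 0 < y)
    {z : SemiEuclid s r} (hz : ell 0 n z = y) :
    Homothetic (connectedComponentIn (ell 0 n ⁻¹' {y}) z) (pseudosphere 0 n) := by
  rw [(isPreconnected_ell_zero_left hn hn2 y).connectedComponentIn hz]
  exact homothetic_ell_preimage 0 n (y' := 1) (by simpa using hy)

theorem IsModel.ell_zero_right_fiber (hk2 : 2 ≤ k) (hk : k ≤ s) {y : ℝ} (hy : y < 0)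
    {z : SemiEuclid s r} (hz : ell k 0 z = y) :
    Homothetic (connectedComponentIn (ell k 0 ⁻¹' {y}) z) (pseudohyperbolic k 0) := by
  rw [(isPreconnected_ell_zero_right hk hk2 y).connectedComponentIn hz]
  exact homothetic_ell_preimage k 0 (y' := -1) (by rw [div_neg, div_one]; linarith)

/-- On `ell k n = 0` the solution equals `v 0 > 0`, so this fiber is not nodal; its level set
contains the origin, which is critical, so it is not regular either. -/
theorem Factors.ne_zero_of_isRegularComponent {v : ℝ → ℝ} (h : Factors u (ell k n) v I)
    (hv0 : 0 < v 0) (hI0 : (0 : ℝ) ∈ I) {S : Set (SemiEuclid s r)}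
    (hS : IsRegularComponent u (ell k n ⁻¹' I) S) :
    ∃ z, ell k n z ≠ 0 ∧ S = connectedComponentIn (ell k n ⁻¹' {ell k n z}) z := by
  obtain ⟨c, hc, hS⟩ := hS
  obtain ⟨z, hz, rfl, rfl⟩ := h.exists_of_isComponent_levelSet hS
  refine ⟨z, fun hz0 => ?_, rfl⟩
  have huz := h.eq z hz
  rw [hz0] at huz
  rcases hc with hc | hc
  · have h0 : (0 : SemiEuclid s r) ∈ ell k n ⁻¹' I := by
      rw [mem_preimage, ell_zero]; exact hI0
    refine hc 0 ⟨h0, ?_⟩ ?_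
    · rw [h.eq 0 h0, ell_zero, huz]
    · rw [h.criticalSet_eq]
      exact ⟨h0, Or.inr ((fderiv_ell_eq_zero k n 0).2 ⟨fun _ _ => rfl, fun _ _ => rfl⟩)⟩
  · rw [hc] at huz
    exact hv0.ne huz

theorem exists_hasModel (hs : 1 ≤ s) (hr : 1 ≤ r) (hk : k ≤ s) (hn : n ≤ r)
    (hkn : k = 0 ∨ n = 0) (hp : 1 < p) (hμ : μ ≠ 0) (hI : IsOpen I) (hIc : I.OrdConnected)
    (hI0 : (0 : ℝ) ∈ I) (hφ : IsGenerator k n φ) (hu : IsSolutionThrough μ p φ I u) :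
    ∃ σ M, HasModel k n φ u I σ M := by
  rcases hφ with ⟨rfl, rfl, a, -, rfl⟩ | ⟨rfl, rfl, ω, h, ε, hω, hε, rfl⟩ | ⟨hpos, rfl⟩
  · obtain ⟨ha, v, hv⟩ := hu.factors_form hp hμ hI hIc hI0
    have hfib : ∀ z, ∃ D, IsTotallyDisconnected D ∧ form a ⁻¹' {form a z} = form a ⁻¹' D :=
      fun z => ⟨_, isTotallyDisconnected_singleton, rfl⟩
    have hlin : ∀ a', form a = form a' → hyperplane a' = hyperplane a := fun a' h => by
      unfold hyperplane; rw [h]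
    rcases lt_or_gt_of_ne ha with ha' | ha'
    · have hM := homothetic_hyperplane_flat_one_zero hs ha'
      exact ⟨Shape.flatTime, flat 1 0, (isTransverse_form ha).hasModel hv rfl hM rfl
        (fun h => by cases h) (fun a' h => by rw [hlin a' h]; exact hM.symm) hfib⟩
    · have hM := homothetic_hyperplane_flat_zero_one hr ha'
      exact ⟨Shape.flatSpace, flat 0 1, (isTransverse_form ha).hasModel hv rfl hM rfl
        (fun h => by cases h) (fun a' h => by rw [hlin a' h]; exact hM.symm) hfib⟩
  · obtain ⟨v, hv⟩ := hu.factors_parabolicFun h hω hε hp hμ hI hIc hI0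
    obtain ⟨e, he⟩ := exists_isTransverse_parabolicFun h ε hω
    refine ⟨Shape.parabolic, parabolicFun h ε ⁻¹' {0}, he.hasModel hv rfl (Homothetic.refl _)
      ⟨ω, h, ε, hω, hε, rfl⟩ (fun _ => rfl) (fun a' h => ?_)
      fun z => ⟨_, isTotallyDisconnected_singleton, rfl⟩⟩
    rw [h]; exact Homothetic.refl _
  · obtain ⟨v, hv, hv0, -⟩ := hu.factors_ell hk hn hp hμ hI hIc hI0
    have hlin : ∀ (M : Set (SemiEuclid s r)) (a : SemiEuclid s r), ell k n = form a →
        Homothetic M (hyperplane a) := fun M a h => absurd h (ell_ne_form hs hr hpos a)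
    rcases hkn with rfl | rfl
    · rcases (by omega : n = 1 ∨ 2 ≤ n) with rfl | hn2
      · have ha : form (spaceVec ⟨0, hr⟩ : SemiEuclid s r) (spaceVec ⟨0, hr⟩) = 1 := by
          rw [form_spaceVec]; simp [spaceVec]
        have hsq : ∀ z : SemiEuclid s r, ell 0 1 z = 1 * form (spaceVec ⟨0, hr⟩) z ^ 2 := fun z => by
          rw [ell_zero_left, sum_ite_lt hr, form_spaceVec]
          simp
          rfl
        have hM := homothetic_hyperplane_flat_zero_one (r := r) (s := s) hr
          (a := spaceVec ⟨0, hr⟩) (by rw [ha]; exact one_pos)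
        refine ⟨Shape.flatSpace, flat 0 1, (isTransverse_form (by rw [ha]; exact one_ne_zero)).hasModel
          (hv.comp_sq one_ne_zero ((contDiff_form _).differentiable (by norm_num)) hsq)
          ?_ hM rfl (fun h => by cases h) (hlin _)
          fun z => ⟨_, isTotallyDisconnected_sq_eq one_ne_zero (ell 0 1 z), ?_⟩⟩
        · ext z; simp only [mem_preimage, hsq]
        · ext w; simp only [mem_preimage, mem_singleton_iff, hsq, mem_ofPred_eq]
      · refine ⟨Shape.sphereSpace, pseudosphere 0 n, ⟨⟨hn2, rfl⟩, hv.continuousAt,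
          (fun h => by cases h), fun S hS => ?_, hlin _, fun V hV => ?_, fun z hz => ?_⟩⟩
        · obtain ⟨z, hz, rfl⟩ := hv.ne_zero_of_isRegularComponent hv0 hI0 hS
          exact IsModel.ell_zero_left_fiber hn2 hn
            (lt_of_le_of_ne (ell_zero_left_nonneg n z) hz.symm) rfl
        · obtain ⟨z, hz, rfl⟩ := hV
          have hcrit : ∀ z : SemiEuclid s r, fderiv ℝ (ell 0 n) z = 0 → ell 0 n z = 0 :=
            fun z hz => flat_subset_nullCone 0 n ((fderiv_ell_eq_zero 0 n z).1 hz)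
          by_cases hd : deriv v (ell 0 n z) = 0
          · rw [hv.connectedComponentIn_criticalSet_of_deriv hcrit hz.1 hd]
            -- For a definite form the zero fiber is itself the focal variety, so both alternatives
            -- for `v'(0)` lead to the same set.
            rcases eq_or_ne (ell 0 n z) 0 with h0 | h0
            · refine Or.inr (Or.inl ⟨by omega, ?_⟩)
              rw [(isPreconnected_ell_zero_left hn hn2 _).connectedComponentIn rfl, h0,
                ell_zero_left_eq_zero]
              exact Homothetic.refl _
            · exact Or.inl (IsModel.ell_zero_left_fiber hn2 hn
                (lt_of_le_of_ne (ell_zero_left_nonneg n z) h0.symm) rfl)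
          · refine Or.inr (Or.inl ⟨by omega, ?_⟩)
            rw [hv.connectedComponentIn_criticalSet_of_deriv_ne hcrit hz hd]
            rw [hv.criticalSet_eq] at hz
            simp only [fderiv_ell_eq_zero, ofPred_mem_eq]
            rw [(convex_flat 0 n).isPreconnected.connectedComponentIn
              ((fderiv_ell_eq_zero 0 n z).1 (hz.2.resolve_left hd))]
            exact Homothetic.refl _
        · exact IsModel.ell_zero_left_fiber hn2 hn
            (lt_of_le_of_ne (ell_zero_left_nonneg n z) hz.symm) rfl
    · rcases (by omega : k = 1 ∨ 2 ≤ k) with rfl | hk2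
      · have ha : form (timeVec ⟨0, hs⟩ : SemiEuclid s r) (timeVec ⟨0, hs⟩) = -1 := by
          rw [form_timeVec]; simp [timeVec]
        have hsq : ∀ z : SemiEuclid s r, ell 1 0 z = -1 * form (timeVec ⟨0, hs⟩) z ^ 2 := fun z => by
          rw [ell_zero_right, sum_ite_lt hs, form_timeVec]
          simp
          rfl
        have hM := homothetic_hyperplane_flat_one_zero (r := r) (s := s) hs
          (a := timeVec ⟨0, hs⟩) (by rw [ha]; norm_num)
        have h1 : (-1 : ℝ) ≠ 0 := by norm_num
        refine ⟨Shape.flatTime, flat 1 0, (isTransverse_form (by rw [ha]; exact h1)).hasModel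
          (hv.comp_sq h1 ((contDiff_form _).differentiable (by norm_num)) hsq)
          ?_ hM rfl (fun h => by cases h) (hlin _)
          fun z => ⟨_, isTotallyDisconnected_sq_eq h1 (ell 1 0 z), ?_⟩⟩
        · ext z; simp only [mem_preimage, hsq]
        · ext w; simp only [mem_preimage, mem_singleton_iff, hsq, mem_ofPred_eq]
      · refine ⟨Shape.sphereTime, pseudohyperbolic k 0, ⟨⟨hk2, rfl⟩, hv.continuousAt,
          (fun h => by cases h), fun S hS => ?_, hlin _, fun V hV => ?_, fun z hz => ?_⟩⟩
        · obtain ⟨z, hz, rfl⟩ := hv.ne_zero_of_isRegularComponent hv0 hI0 hS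
          exact IsModel.ell_zero_right_fiber hk2 hk
            (lt_of_le_of_ne (ell_zero_right_nonpos k z) hz) rfl
        · obtain ⟨z, hz, rfl⟩ := hV
          have hcrit : ∀ z : SemiEuclid s r, fderiv ℝ (ell k 0) z = 0 → ell k 0 z = 0 :=
            fun z hz => flat_subset_nullCone k 0 ((fderiv_ell_eq_zero k 0 z).1 hz)
          by_cases hd : deriv v (ell k 0 z) = 0
          · rw [hv.connectedComponentIn_criticalSet_of_deriv hcrit hz.1 hd]
            rcases eq_or_ne (ell k 0 z) 0 with h0 | h0
            · refine Or.inr (Or.inr ⟨by omega, ?_⟩)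
              rw [(isPreconnected_ell_zero_right hk hk2 _).connectedComponentIn rfl, h0,
                ell_zero_right_eq_zero]
              exact Homothetic.refl _
            · exact Or.inl (IsModel.ell_zero_right_fiber hk2 hk
                (lt_of_le_of_ne (ell_zero_right_nonpos k z) h0) rfl)
          · refine Or.inr (Or.inr ⟨by omega, ?_⟩)
            rw [hv.connectedComponentIn_criticalSet_of_deriv_ne hcrit hz hd]
            rw [hv.criticalSet_eq] at hz
            simp only [fderiv_ell_eq_zero, ofPred_mem_eq]
            rw [(convex_flat k 0).isPreconnected.connectedComponentIn
              ((fderiv_ell_eq_zero k 0 z).1 (hz.2.resolve_left hd))]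
            exact Homothetic.refl _
        · exact IsModel.ell_zero_right_fiber hk2 hk
            (lt_of_le_of_ne (ell_zero_right_nonpos k z) hz) rfl

theorem HasModel.hasUniqueShape (hs : 1 ≤ s) (hr : 1 ≤ r) (hkn : k = 0 ∨ n = 0) {σ : Shape}
    {M : Set (SemiEuclid s r)} (h : HasModel k n φ u I σ M) :
    HasUniqueShape k n u (φ ⁻¹' I) σ M :=
  ⟨h.isModel, h.regular, fun _ _ S hM' hS hSM' =>
    h.isModel.shape_unique hs hr hkn hM' ((h.regular S hS).symm.trans hSM')⟩

end Solutions

section Solutions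

variable {k n : ℕ} {μ p : ℝ} {φ u : SemiEuclid s r → ℝ} {I : Set ℝ}

/-! ### Blow-up sets in the definite cases -/

theorem IsGenerator.continuous (h : IsGenerator k n φ) : Continuous φ := by
  rcases h with ⟨-, -, a, -, rfl⟩ | ⟨-, -, ω, h, ε, -, -, rfl⟩ | ⟨-, rfl⟩
  · exact continuous_form a
  · exact (contDiff_parabolicFun h ε).continuous
  · exact continuous_ell k n

theorem IsGenerator.exists_isTransverse (hp : 1 < p) (hμ : μ ≠ 0) (hI : IsOpen I)
    (hIc : I.OrdConnected) (hI0 : (0 : ℝ) ∈ I) (h : IsGenerator 0 0 φ)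
    (hu : IsSolutionThrough μ p φ I u) : φ 0 = 0 ∧ ∃ e, IsTransverse φ e := by
  rcases h with ⟨-, -, a, -, rfl⟩ | ⟨-, -, ω, h, ε, hω, -, rfl⟩ | ⟨h, -⟩
  · exact ⟨form_zero_right a, _, isTransverse_form (hu.factors_form hp hμ hI hIc hI0).1⟩
  · exact ⟨by simp [parabolicFun], exists_isTransverse_parabolicFun h ε hω⟩
  · exact absurd h (lt_irrefl 0)

theorem IsGenerator.eq_ell (h : IsGenerator k n φ) (hkn : 0 < k + n) : φ = ell k n := by
  rcases h with ⟨rfl, rfl, -⟩ | ⟨rfl, rfl, -⟩ | ⟨-, h⟩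
  · exact absurd hkn (lt_irrefl 0)
  · exact absurd hkn (lt_irrefl 0)
  · exact h

theorem HasModel.homothetic_of_isComponent_preimage {σ : Shape} {M : Set (SemiEuclid s r)}
    (h : HasModel k n φ u I σ M) (hφ : Continuous φ) {T : Set ℝ} (hT : IsTotallyDisconnected T)
    (hT0 : (0 : ℝ) ∉ T) {B : Set (SemiEuclid s r)} (hB : IsComponent B (φ ⁻¹' T)) :
    Homothetic B M := by
  obtain ⟨z, hz, rfl⟩ := hB
  rw [connectedComponentIn_eq_inter_fiber (F := φ ⁻¹' T) hφ hT (fun _ h => h) hz, inter_eq_right.2]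
  · exact h.fiber z fun h0 => hT0 (by rw [← h0]; exact hz)
  · intro w hw
    rw [mem_preimage, mem_singleton_iff] at hw
    rw [mem_preimage, hw]; exact hz

theorem blowUpSet_ell_Iio {R : ℝ} (hR : 0 < R) (hu : ∀ z ∈ ell k n ⁻¹' Iio R, ContinuousAt u z)
    (h : BlowsUpAs (ell k n) (Iio R) u R) : blowUpSet u (ell k n ⁻¹' Iio R) = ell k n ⁻¹' {R} := by
  refine blowUpSet_eq (continuous_ell k n) isOpen_Iio hu (fun _ h' => by rw [h']; exact h) ?_ ?_
  · rw [closure_Iio]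
    intro y hy
    exact (lt_or_eq_of_le (show y ≤ R from hy)).imp id id
  · rintro _ rfl z hz
    refine mem_closure_of_ell fun c hc => ?_
    rw [hz, mem_Iio]
    nlinarith [hc.1, hc.2, mul_pos hR (sub_pos.2 hc.2), mul_pos (mul_pos hR hc.1) (sub_pos.2 hc.2)]

theorem blowUpSet_ell_Ioi {R : ℝ} (hR : 0 < R) (hu : ∀ z ∈ ell k n ⁻¹' Ioi (-R), ContinuousAt u z)
    (h : BlowsUpAs (ell k n) (Ioi (-R)) u (-R)) :
    blowUpSet u (ell k n ⁻¹' Ioi (-R)) = ell k n ⁻¹' {-R} := by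
  refine blowUpSet_eq (continuous_ell k n) isOpen_Ioi hu (fun _ h' => by rw [h']; exact h) ?_ ?_
  · rw [closure_Ioi]
    intro y hy
    exact (lt_or_eq_of_le (show -R ≤ y from hy)).imp id Eq.symm
  · rintro _ rfl z hz
    refine mem_closure_of_ell fun c hc => ?_
    rw [hz, mem_Ioi]
    nlinarith [hc.1, hc.2, mul_pos hR (sub_pos.2 hc.2), mul_pos (mul_pos hR hc.1) (sub_pos.2 hc.2)]

theorem IsY4.domain (h : IsY4 k n μ p φ I u) :
    IsOpen I ∧ I.OrdConnected ∧ (0 : ℝ) ∈ I ∧ (k = 0 ∨ n = 0) := by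
  obtain ⟨-, -, R, hR, ⟨hk, -, rfl, -⟩ | ⟨hk, -, rfl, -⟩ | ⟨-, hn, rfl, -⟩⟩ := h
  · exact ⟨isOpen_Ioo, ordConnected_Ioo, ⟨by linarith, hR⟩, Or.inl hk⟩
  · exact ⟨isOpen_Iio, ordConnected_Iio, hR, Or.inl hk⟩
  · exact ⟨isOpen_Ioi, ordConnected_Ioi, by rw [mem_Ioi]; linarith, Or.inr hn⟩

theorem IsY4.exists_blowUpSet_eq (hs : 1 ≤ s) (hr : 1 ≤ r) (hp : 1 < p) (hμ : μ ≠ 0)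
    (h : IsY4 k n μ p φ I u) (hu : ∀ z ∈ φ ⁻¹' I, ContinuousAt u z) :
    ∃ T : Set ℝ, IsTotallyDisconnected T ∧ (0 : ℝ) ∉ T ∧ blowUpSet u (φ ⁻¹' I) = φ ⁻¹' T ∧
      (φ ⁻¹' T).Nonempty := by
  obtain ⟨hI, hIc, hI0, -⟩ := h.domain
  obtain ⟨hφ, hsol, R, hR, ⟨rfl, rfl, rfl, hb, hb'⟩ | ⟨rfl, hn, rfl, hb⟩ | ⟨hk, rfl, rfl, hb⟩⟩ := h
  · obtain ⟨h0, e, he⟩ := hφ.exists_isTransverse hp hμ hI hIc hI0 hsol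
    have hcl : closure (Ioo (-R) R) = Icc (-R) R := closure_Ioo (by linarith)
    -- Both ends blow up here. That `0` is not among the end values matters because fibers are
    -- described by the model only over nonzero values.
    refine ⟨{-R, R}, (isTotallyDisconnected_insert isTotallyDisconnected_singleton _), ?_, ?_,
      ⟨0 + R • e, ?_⟩⟩
    · rintro (h | h)
      · linarith
      · exact hR.ne h
    · refine blowUpSet_eq hφ.continuous hI hu ?_ ?_ ?_
      · rintro _ (rfl | rfl)
        · exact hb'
        · exact hb
      · rw [hcl]
        rintro y ⟨hy1, hy2⟩
        rcases lt_or_eq_of_le hy1 with h1 | h1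
        · rcases lt_or_eq_of_le hy2 with h2 | h2
          · exact Or.inl ⟨h1, h2⟩
          · exact Or.inr (Or.inr h2)
        · exact Or.inr (Or.inl h1.symm)
      · intro y hy z hz
        refine he.mem_closure ?_
        rw [hcl, hz]
        rcases hy with rfl | rfl
        · exact ⟨le_rfl, by linarith⟩
        · exact ⟨by linarith, le_rfl⟩
    · rw [mem_preimage, he, h0]
      exact Or.inr (zero_add R)
  · obtain rfl := hφ.eq_ell (by omega)
    exact ⟨{R}, isTotallyDisconnected_singleton, fun h => hR.ne h, blowUpSet_ell_Iio hR hu hb,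
      exists_ell_eq_of_nonneg hr hn hR.le⟩
  · obtain rfl := hφ.eq_ell (by omega)
    refine ⟨{-R}, isTotallyDisconnected_singleton, fun h => ?_, blowUpSet_ell_Ioi hR hu hb,
      exists_ell_eq_of_nonpos hs hk (by linarith)⟩
    have : (0 : ℝ) = -R := h
    linarith

/-! ### The indefinite case -/

theorem homotheticToComponent_of_ell_ne_zero {z : SemiEuclid s r} (hz : ell k n z ≠ 0) :
    HomotheticToComponent (connectedComponentIn (ell k n ⁻¹' {ell k n z}) z) (pseudosphere k n) ∨
    HomotheticToComponent (connectedComponentIn (ell k n ⁻¹' {ell k n z}) z)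
      (pseudohyperbolic k n) := by
  rcases lt_or_gt_of_ne hz with h | h
  · obtain ⟨z', hz', hh⟩ := connectedComponentIn_ell_preimage k n (y' := -1)
      (by rw [div_neg, div_one]; linarith) (rfl : ell k n z = _)
    exact Or.inr ⟨_, ⟨z', hz', rfl⟩, hh⟩
  · obtain ⟨z', hz', hh⟩ := connectedComponentIn_ell_preimage k n (y' := 1)
      (by simpa using h) (rfl : ell k n z = _)
    exact Or.inl ⟨_, ⟨z', hz', rfl⟩, hh⟩

/-- Surjectivity of `ell k n` puts all of `[a, b]` in the range of the generator. The chosen value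
differs from `v 0`, so the critical points of `ell k n` stay off its level set. -/
theorem Factors.exists_isRegularComponent {v : ℝ → ℝ} (h : Factors u (ell k n) v I)
    (hrange : ∀ y : ℝ, ∃ z : SemiEuclid s r, ell k n z = y) {a b : ℝ} (hab : a < b)
    (hI : Icc a b ⊆ I) : ∃ y ∈ Icc a b, ∀ z : SemiEuclid s r, ell k n z = y →
      IsRegularComponent u (ell k n ⁻¹' I) (connectedComponentIn (ell k n ⁻¹' {y}) z) := by
  obtain ⟨y, hy, hy0, hreg⟩ := h.nowhereConstant.exists_regular_value
    (fun y hy => h.differentiableAt y hy.1) (v 0) hab fun y hy => ⟨hI hy, hrange y⟩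
  refine ⟨y, hy, fun z hz => ?_⟩
  subst hz
  have hzI := hI hy
  refine ⟨u z, Or.inl fun w hw hwc => ?_, z, ⟨hzI, rfl⟩,
    (h.connectedComponentIn_levelSet hzI).symm⟩
  rw [h.criticalSet_eq] at hwc
  have hvw : v (ell k n w) = v (ell k n z) := by
    rw [← h.eq w hw.1, ← h.eq z hzI, hw.2]
  rcases hwc.2 with hd | hd
  · exact hreg _ ⟨hwc.1, w, rfl⟩ hvw hd
  · have : ell k n w = 0 := flat_subset_nullCone k n ((fderiv_ell_eq_zero k n w).1 hd)
    rw [this] at hvw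
    exact hy0 hvw.symm

theorem isPreconnected_ell_preimage_zero (k n : ℕ) :
    IsPreconnected (ell k n ⁻¹' {0} : Set (SemiEuclid s r)) := isPreconnected_nullCone k n

theorem connectedComponentIn_ell_preimage_zero {z : SemiEuclid s r} (hz : ell k n z = 0) :
    connectedComponentIn (ell k n ⁻¹' {0}) z = nullCone k n :=
  (isPreconnected_ell_preimage_zero k n).connectedComponentIn hz

theorem IsMixedBlowUp.description (hs : 1 ≤ s) (hr : 1 ≤ r) (hk : k ≤ s) (hn : n ≤ r)
    (hp : 1 < p) (hμ : μ ≠ 0) (h : IsMixedBlowUp k n μ p φ I u) :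
    (∀ S, IsRegularComponent u (φ ⁻¹' I) S →
      HomotheticToComponent S (pseudosphere k n) ∨
      HomotheticToComponent S (pseudohyperbolic k n)) ∧
    (∃ S, IsRegularComponent u (φ ⁻¹' I) S ∧ HomotheticToComponent S (pseudosphere k n)) ∧
    (∃ S, IsRegularComponent u (φ ⁻¹' I) S ∧ HomotheticToComponent S (pseudohyperbolic k n)) ∧
    (∀ V, IsComponent V (criticalSet u (φ ⁻¹' I)) →
      HomotheticToComponent V (pseudosphere k n) ∨
      HomotheticToComponent V (pseudohyperbolic k n) ∨ V = flat k n) ∧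
    (∀ c W, (∃ z ∈ criticalSet u (φ ⁻¹' I), u z = c) →
      IsComponent W (levelSet u (φ ⁻¹' I) c) →
      HomotheticToComponent W (pseudosphere k n) ∨
      HomotheticToComponent W (pseudohyperbolic k n) ∨ Homothetic W (nullCone k n)) ∧
    IsComponent (flat k n) (criticalSet u (φ ⁻¹' I)) ∧
    IsComponent (nullCone k n) (levelSet u (φ ⁻¹' I) (u 0)) ∧
    (blowUpSet u (φ ⁻¹' I)).Nonempty ∧
    ∀ B, IsComponent B (blowUpSet u (φ ⁻¹' I)) →
      ∃ S, IsRegularComponent u (φ ⁻¹' I) S ∧ Homothetic B S := by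
  obtain ⟨hk0, hn0, hφ, hsol, R, hR, hcase⟩ := h
  obtain rfl := hφ.eq_ell (by omega)
  have hdom : IsOpen I ∧ I.OrdConnected ∧ Ioo (-R) R ⊆ I := by
    rcases hcase with ⟨rfl, -⟩ | ⟨rfl, -⟩
    · exact ⟨isOpen_Iio, ordConnected_Iio, fun y hy => hy.2⟩
    · exact ⟨isOpen_Ioi, ordConnected_Ioi, fun y hy => hy.1⟩
  obtain ⟨hI, hIc, hRI⟩ := hdom
  have hI0 : (0 : ℝ) ∈ I := hRI ⟨by linarith, hR⟩
  obtain ⟨v, hv, hv0, hv0'⟩ := hsol.factors_ell hk hn hp hμ hI hIc hI0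
  have hrange : ∀ y : ℝ, ∃ z : SemiEuclid s r, ell k n z = y := fun y =>
    (le_total 0 y).elim (exists_ell_eq_of_nonneg hr hn0) (exists_ell_eq_of_nonpos hs hk0)
  have hcrit : ∀ z : SemiEuclid s r, fderiv ℝ (ell k n) z = 0 → ell k n z = 0 :=
    fun z hz => flat_subset_nullCone k n ((fderiv_ell_eq_zero k n z).1 hz)
  -- The interval `(-R, R)` lies in `I` whichever end blows up, so regular levels can be chosen on
  -- both sides of the null cone.
  obtain ⟨y₁, hy₁, hreg₁⟩ := hv.exists_isRegularComponent hrange (a := R / 3) (b := R / 2)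
    (by linarith) fun y hy => hRI ⟨by linarith [hy.1], by linarith [hy.2]⟩
  obtain ⟨y₂, hy₂, hreg₂⟩ := hv.exists_isRegularComponent hrange (a := -R / 2) (b := -R / 3)
    (by linarith) fun y hy => hRI ⟨by linarith [hy.1], by linarith [hy.2]⟩
  have hy₁0 : 0 < y₁ := by linarith [hy₁.1]
  have hy₂0 : y₂ < 0 := by linarith [hy₂.2]
  have h0mem : (0 : SemiEuclid s r) ∈ ell k n ⁻¹' I := by
    rw [mem_preimage, ell_zero]; exact hI0
  have hflat0 : (0 : SemiEuclid s r) ∈ flat k n := ⟨fun _ _ => rfl, fun _ _ => rfl⟩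
  -- Since `v'(0) ≠ 0`, the critical points on the null cone are the critical points of `ell k n`,
  -- which form a linear subspace.
  have hflat : ∀ z ∈ criticalSet u (ell k n ⁻¹' I), ell k n z = 0 →
      connectedComponentIn (criticalSet u (ell k n ⁻¹' I)) z = flat k n := by
    intro z hz hz0
    have hd : deriv v (ell k n z) ≠ 0 := by rwa [hz0]
    rw [hv.connectedComponentIn_criticalSet_of_deriv_ne hcrit hz hd]
    rw [hv.criticalSet_eq] at hz
    simp only [fderiv_ell_eq_zero, ofPred_mem_eq]
    exact (convex_flat k n).isPreconnected.connectedComponentIn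
      ((fderiv_ell_eq_zero k n z).1 (hz.2.resolve_left hd))
  have h0crit : (0 : SemiEuclid s r) ∈ criticalSet u (ell k n ⁻¹' I) := by
    rw [hv.criticalSet_eq]
    exact ⟨h0mem, Or.inr ((fderiv_ell_eq_zero k n 0).2 hflat0)⟩
  refine ⟨fun S hS => ?_, ?_, ?_, fun V hV => ?_, fun c W _ hW => ?_, ?_, ?_, ?_⟩
  · obtain ⟨z, hz, rfl⟩ := hv.ne_zero_of_isRegularComponent hv0 hI0 hS
    exact homotheticToComponent_of_ell_ne_zero hz
  · obtain ⟨z, hz⟩ := hrange y₁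
    obtain ⟨z', hz', hh⟩ := connectedComponentIn_ell_preimage k n (y' := 1)
      (by simpa using hy₁0) hz
    exact ⟨_, hreg₁ z hz, _, ⟨z', hz', rfl⟩, hh⟩
  · obtain ⟨z, hz⟩ := hrange y₂
    obtain ⟨z', hz', hh⟩ := connectedComponentIn_ell_preimage k n (y' := -1)
      (by rw [div_neg, div_one]; linarith) hz
    exact ⟨_, hreg₂ z hz, _, ⟨z', hz', rfl⟩, hh⟩
  · obtain ⟨z, hz, rfl⟩ := hV
    rcases eq_or_ne (ell k n z) 0 with hz0 | hz0
    · exact Or.inr (Or.inr (hflat z hz hz0))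
    · have hz' := hz
      rw [hv.criticalSet_eq] at hz'
      rw [hv.connectedComponentIn_criticalSet_of_deriv hcrit hz.1
        (hz'.2.resolve_right fun h => hz0 (hcrit z h))]
      exact (homotheticToComponent_of_ell_ne_zero hz0).imp_right Or.inl
  · obtain ⟨z, hz, -, rfl⟩ := hv.exists_of_isComponent_levelSet hW
    rcases eq_or_ne (ell k n z) 0 with hz0 | hz0
    · refine Or.inr (Or.inr ?_)
      rw [hz0, connectedComponentIn_ell_preimage_zero hz0]
      exact Homothetic.refl _
    · exact (homotheticToComponent_of_ell_ne_zero hz0).imp_right Or.inl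
  · exact ⟨0, h0crit, (hflat 0 h0crit (ell_zero k n)).symm⟩
  · refine ⟨0, ⟨h0mem, rfl⟩, ?_⟩
    rw [hv.connectedComponentIn_levelSet h0mem, ell_zero,
      connectedComponentIn_ell_preimage_zero (ell_zero k n)]
  · obtain ⟨T, y, hblow, hdiv, hreg⟩ : ∃ T y : ℝ,
        blowUpSet u (ell k n ⁻¹' I) = ell k n ⁻¹' {T} ∧ 0 < T / y ∧
        ∀ z : SemiEuclid s r, ell k n z = y →
          IsRegularComponent u (ell k n ⁻¹' I) (connectedComponentIn (ell k n ⁻¹' {y}) z) := by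
      rcases hcase with ⟨rfl, hb⟩ | ⟨rfl, hb⟩
      · exact ⟨R, y₁, blowUpSet_ell_Iio hR hv.continuousAt hb, div_pos hR hy₁0, hreg₁⟩
      · exact ⟨-R, y₂, blowUpSet_ell_Ioi hR hv.continuousAt hb,
          div_pos_of_neg_of_neg (by linarith) hy₂0, hreg₂⟩
    rw [hblow]
    refine ⟨hrange T, ?_⟩
    rintro _ ⟨z, hz, rfl⟩
    obtain ⟨z', hz', hh⟩ := connectedComponentIn_ell_preimage k n hdiv hz
    exact ⟨_, hreg z' hz', hh⟩

end Solutions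

end SemiEuclid

end

/-! ### The three groups of solutions -/

theorem mainTheorem3 (s r k n : ℕ) (hs : 1 ≤ s) (hr : 1 ≤ r) (hm : 3 ≤ s + r)
    (hk : k ≤ s) (hn : n ≤ r) (p μ : ℝ) (hp : 1 < p) (hμ : μ ≠ 0)
    (φ : SemiEuclid s r → ℝ) (I : Set ℝ) (u : SemiEuclid s r → ℝ) :
    -- (Y1) and (Y4)
    (SemiEuclid.IsY1 k n μ p φ I u ∨ SemiEuclid.IsY4 k n μ p φ I u →
      ∃ (σ : SemiEuclid.Shape) (M : Set (SemiEuclid s r)),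
        SemiEuclid.HasUniqueShape k n u (φ ⁻¹' I) σ M ∧
        (∀ a : SemiEuclid s r, φ = SemiEuclid.form a →
          ∀ S, SemiEuclid.IsRegularComponent u (φ ⁻¹' I) S →
            SemiEuclid.Homothetic S (SemiEuclid.hyperplane a)) ∧
        SemiEuclid.CriticalModelOrFocal k n u (φ ⁻¹' I) M ∧
        (SemiEuclid.IsY4 k n μ p φ I u →
          (SemiEuclid.blowUpSet u (φ ⁻¹' I)).Nonempty ∧
          ∀ B, SemiEuclid.IsComponent B (SemiEuclid.blowUpSet u (φ ⁻¹' I)) →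
            SemiEuclid.Homothetic B M ∧
            ∀ S, SemiEuclid.IsRegularComponent u (φ ⁻¹' I) S → SemiEuclid.Homothetic B S)) ∧
    -- (Y2) and (Y3)
    (SemiEuclid.IsY2 k n μ p φ I u ∨ SemiEuclid.IsY3 k n μ p φ I u →
      ∃ (σ : SemiEuclid.Shape) (M : Set (SemiEuclid s r)),
        σ ≠ SemiEuclid.Shape.parabolic ∧
        SemiEuclid.HasUniqueShape k n u (φ ⁻¹' I) σ M ∧
        SemiEuclid.CriticalModelOrFocal k n u (φ ⁻¹' I) M) ∧
    -- (Y5) and (Y6)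
    (SemiEuclid.IsY5 k n μ p φ I u ∨ SemiEuclid.IsY6 k n μ p φ I u →
      -- regular level sets
      (∀ S, SemiEuclid.IsRegularComponent u (φ ⁻¹' I) S →
        SemiEuclid.HomotheticToComponent S (SemiEuclid.pseudosphere k n) ∨
        SemiEuclid.HomotheticToComponent S (SemiEuclid.pseudohyperbolic k n)) ∧
      -- both options occur
      (∃ S, SemiEuclid.IsRegularComponent u (φ ⁻¹' I) S ∧
        SemiEuclid.HomotheticToComponent S (SemiEuclid.pseudosphere k n)) ∧
      (∃ S, SemiEuclid.IsRegularComponent u (φ ⁻¹' I) S ∧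
        SemiEuclid.HomotheticToComponent S (SemiEuclid.pseudohyperbolic k n)) ∧
      -- components of the critical set
      (∀ V, SemiEuclid.IsComponent V (SemiEuclid.criticalSet u (φ ⁻¹' I)) →
        SemiEuclid.HomotheticToComponent V (SemiEuclid.pseudosphere k n) ∨
        SemiEuclid.HomotheticToComponent V (SemiEuclid.pseudohyperbolic k n) ∨
        V = SemiEuclid.flat k n) ∧
      -- components of the level sets that meet the critical set
      (∀ c W, (∃ z ∈ SemiEuclid.criticalSet u (φ ⁻¹' I), u z = c) →
        SemiEuclid.IsComponent W (SemiEuclid.levelSet u (φ ⁻¹' I) c) →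
        SemiEuclid.HomotheticToComponent W (SemiEuclid.pseudosphere k n) ∨
        SemiEuclid.HomotheticToComponent W (SemiEuclid.pseudohyperbolic k n) ∨
        SemiEuclid.Homothetic W (SemiEuclid.nullCone k n)) ∧
      -- the subspace and the null cone do occur
      SemiEuclid.IsComponent (SemiEuclid.flat k n) (SemiEuclid.criticalSet u (φ ⁻¹' I)) ∧
      SemiEuclid.IsComponent (SemiEuclid.nullCone k n)
        (SemiEuclid.levelSet u (φ ⁻¹' I) (u 0)) ∧
      -- blow-up
      (SemiEuclid.blowUpSet u (φ ⁻¹' I)).Nonempty ∧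
      ∀ B, SemiEuclid.IsComponent B (SemiEuclid.blowUpSet u (φ ⁻¹' I)) →
        ∃ S, SemiEuclid.IsRegularComponent u (φ ⁻¹' I) S ∧ SemiEuclid.Homothetic B S) := by
  refine ⟨fun h => ?_, fun h => ?_, fun h => ?_⟩
  · have hdom : IsOpen I ∧ I.OrdConnected ∧ (0 : ℝ) ∈ I ∧ (k = 0 ∨ n = 0) ∧
        SemiEuclid.IsGenerator k n φ ∧ SemiEuclid.IsSolutionThrough μ p φ I u := by
      rcases h with ⟨hkn, hφ, rfl, hu⟩ | h
      · exact ⟨isOpen_univ, ordConnected_univ, mem_univ _, by omega, hφ, hu⟩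
      · obtain ⟨hI, hIc, hI0, hkn⟩ := h.domain
        exact ⟨hI, hIc, hI0, hkn, h.1, h.2.1⟩
    obtain ⟨hI, hIc, hI0, hkn, hφ, hu⟩ := hdom
    obtain ⟨σ, M, hM⟩ := SemiEuclid.exists_hasModel hs hr hk hn hkn hp hμ hI hIc hI0 hφ hu
    refine ⟨σ, M, hM.hasUniqueShape hs hr hkn, fun a ha S hS => (hM.regular S hS).trans
      (hM.linear a ha), hM.critical, fun h4 => ?_⟩
    obtain ⟨T, hT, hT0, hblow, hne⟩ := h4.exists_blowUpSet_eq hs hr hp hμ hM.continuousAt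
    rw [hblow]
    refine ⟨hne, fun B hB => ?_⟩
    have hBM := hM.homothetic_of_isComponent_preimage hφ.continuous hT hT0 hB
    exact ⟨hBM, fun S hS => hBM.trans (hM.regular S hS).symm⟩
  · have hdom : 2 ≤ k + n ∧ I = univ ∧ (k = 0 ∨ n = 0) ∧
        SemiEuclid.IsGenerator k n φ ∧ SemiEuclid.IsSolutionThrough μ p φ I u := by
      rcases h with ⟨h2, hkn, -, hφ, hI, hu⟩ | ⟨h2, hkn, -, hφ, hI, hu⟩
      · exact ⟨h2, hI, hkn, hφ, hu⟩
      · exact ⟨h2.le, hI, hkn, hφ, hu⟩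
    obtain ⟨h2, rfl, hkn, hφ, hu⟩ := hdom
    obtain ⟨σ, M, hM⟩ := SemiEuclid.exists_hasModel hs hr hk hn hkn hp hμ isOpen_univ
      ordConnected_univ (mem_univ _) hφ hu
    -- A parabolic model arises only for `k + n = 0`, whereas here `k + n ≥ 2`.
    refine ⟨σ, M, fun hσ => ?_, hM.hasUniqueShape hs hr hkn, hM.critical⟩
    have := hM.parabolic hσ
    omega
  · refine SemiEuclid.IsMixedBlowUp.description hs hr hk hn hp hμ (φ := φ) (I := I) (u := u) ?_
    rcases h with h | h
    · exact h.2
    · exact h.2.2
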